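/- \textbf{Setting.} Let $F$ be a number field with algebraic closure $\bar F$, $G_F=\mathrm{Gal}(\bar F/F)$, let $p$ be a prime, and for each place $v$ of $F$ (finite or archimedean) let $F_v$ be the completion, $G_v=\mathrm{Gal}(\bar F_v/F_v)$, mapped to $G_F$ by means of a chosen embedding $\bar F\hookrightarrow\bar F_v$, and $I_v\subseteq G_v$ the inertia subgroup ($I_v=G_v$ if $v$ is archimedean). Let $F_\infty/F$ be a $\mathbb Z_p$-extension, unramified outside $p$ and totally ramified at every $v\mid p$, and let $F_n\subset F_\infty$ be the subextension with $\mathrm{Gal}(F_n/F)\simeq\mathbb Z/p^n\mathbb Z$. Let $R$ be a complete noetherian regular local ring of Krull dimension $\ge 1$ with finite residue field of characteristic $p$, and put $G_\infty=\mathrm{Gal}(F_\infty/F)$, $\Lambda=R[[G_\infty]]=\varprojlim_n R[\mathrm{Gal}(F_n/F)]$ with the inverse limit topology. A $\Lambda$-module is \emph{pseudo-null} if its support contains only prime ideals of height at least $2$. For a discrete or compact $\Lambda$-module $X$ let $X^\vee=\mathrm{Hom}_{\mathrm{cont}}(X,\mathbb Q_p/\mathbb Z_p)$ be its Pontryagin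 dual; let $X^*=\mathrm{Hom}_\Lambda(X,\Lambda)$, and let $X[\mathfrak q]$ denote $\mathfrak q$-torsion. Let $\mathbf T$ be a finite free $\Lambda$-module with a continuous $\Lambda$-linear action of $G_F$, unramified outside a finite set $\Sigma$ of places of $F$ containing the set $\Sigma_p$ of places dividing $p$. For each $v\in\Sigma_p$ fix a $\Lambda$-submodule $F_v^+(\mathbf T)\subseteq\mathbf T$ stable under $G_v$. Let $\mathbf A=\mathbf T\otimes_\Lambda\Lambda^\vee$, with the discrete topology, and let $F_v^+(\mathbf A)\subseteq\mathbf A$ be the image of $F_v^+(\mathbf T)\otimes_\Lambda\Lambda^\vee$. For an ideal $\mathfrak q\subseteq\Lambda$ let $F_v^+(\mathbf A[\mathfrak q])=\mathbf A[\mathfrak q]\cap F_v^+(\mathbf A)$. For $M=\mathbf A$ or $M=\mathbf A[\mathfrak q]$ define, with continuous cohomology, \[\mathrm{Sel}(F,M)=\ker\Bigl(H^1(F,M)\to\prod_{v\notin\Sigma_p}H^1(I_v,M)\times\prod_{v\in\Sigma_p}H^1(I_v,M/F_v^+(M))\Bigr),\] \[\mathrm{Sel}_{\mathrm{str}}(F,M)=\ker\Bigl(H^1(F,M)\to\prod_{v\notin\Sigma_p}H^1(I_v,M)\times\prod_{v\in\Sigma_p}H^1(F_v,M/F_v^+(M))\Bigr).\]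 The inclusion $\mathbf A[\mathfrak q]\subseteq\mathbf A$ induces $\Lambda$-linear maps \[r_{\mathfrak q}:\mathrm{Sel}(F,\mathbf A[\mathfrak q])\to\mathrm{Sel}(F,\mathbf A)[\mathfrak q],\qquad r_{\mathfrak q}^{\mathrm{str}}:\mathrm{Sel}_{\mathrm{str}}(F,\mathbf A[\mathfrak q])\to\mathrm{Sel}_{\mathrm{str}}(F,\mathbf A)[\mathfrak q].\] For $v\in\Sigma\smallsetminus\Sigma_p$ let $C_v=C_v^{\mathrm{str}}$ be the $\Lambda$-torsion submodule of the coinvariants $(\mathbf T^*)_{I_v}$. For $v\in\Sigma_p$ let $C_v$ and $C_v^{\mathrm{str}}$ be the $\Lambda$-torsion submodules of $((\mathbf T/F_v^+(\mathbf T))^*)_{I_v}$ and $((\mathbf T/F_v^+(\mathbf T))^*)_{G_v}$ respectively. Let $F_\Sigma$ be the maximal extension of $F$ unramified outside $\Sigma$. \textbf{Theorem.} Let $\mathfrak q=(g)$ be a principal ideal of $\Lambda$, and assume that $H^0(F_\Sigma/F,\mathbf A[\mathfrak q])^\vee$ is pseudo-null. (1) If $C_v/\mathfrak qC_v$ is pseudo-null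 for every $v\in\Sigma$, then $\ker(r_{\mathfrak q})^\vee$ and $\mathrm{coker}(r_{\mathfrak q})^\vee$ are pseudo-null $\Lambda$-modules. (2) If $C_v^{\mathrm{str}}/\mathfrak qC_v^{\mathrm{str}}$ is pseudo-null for every $v\in\Sigma$, then $\ker(r_{\mathfrak q}^{\mathrm{str}})^\vee$ and $\mathrm{coker}(r_{\mathfrak q}^{\mathrm{str}})^\vee$ are pseudo-null $\Lambda$-modules. -/

import Mathlib

open scoped NumberField TensorProduct

namespace SelmerControl

noncomputable section

/-! ### Continuous cohomology in degree one with discrete coefficients -/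

section Cohomology

variable {Λ G H M N : Type*} [CommRing Λ]
  [Group G] [TopologicalSpace G] [Group H] [TopologicalSpace H]
  [AddCommGroup M] [Module Λ M] [AddCommGroup N] [Module Λ N]

/-- Continuous `1`-cocycles (crossed homomorphisms) of a topological group `G` with values in a
`Λ[G]`-module `M` carrying the discrete topology. -/
def Z1 (ρ : Representation Λ G M) : Submodule Λ (G → M) where
  carrier := {c | IsLocallyConstant c ∧ ∀ σ τ, c (σ * τ) = c σ + ρ σ (c τ)}
  zero_mem' := ⟨IsLocallyConstant.const 0, fun σ τ => by simp⟩
  add_mem' := by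
    rintro a b ⟨ha, ha'⟩ ⟨hb, hb'⟩
    refine ⟨ha.add hb, fun σ τ => ?_⟩
    simp only [Pi.add_apply, ha', hb', map_add]
    abel
  smul_mem' := by
    rintro r a ⟨ha, ha'⟩
    refine ⟨ha.comp (fun m => r • m), fun σ τ => ?_⟩
    simp only [Pi.smul_apply, ha', smul_add, map_smul]

/-- The `1`-coboundaries `σ ↦ σ m - m`. -/
def B1 (ρ : Representation Λ G M) : Submodule Λ (G → M) :=
  LinearMap.range (LinearMap.pi fun σ => ρ σ - LinearMap.id)

/-- The continuous cohomology group `H¹(G, M)` of the discrete module `M`. -/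
def H1 (ρ : Representation Λ G M) : Type _ :=
  Z1 ρ ⧸ (B1 ρ).comap (Z1 ρ).subtype

instance (ρ : Representation Λ G M) : AddCommGroup (H1 ρ) :=
  inferInstanceAs (AddCommGroup (Z1 ρ ⧸ (B1 ρ).comap (Z1 ρ).subtype))

instance (ρ : Representation Λ G M) : Module Λ (H1 ρ) :=
  inferInstanceAs (Module Λ (Z1 ρ ⧸ (B1 ρ).comap (Z1 ρ).subtype))

/-- The class of a cocycle. -/
def H1.mk (ρ : Representation Λ G M) : Z1 ρ →ₗ[Λ] H1 ρ :=
  Submodule.mkQ ((B1 ρ).comap (Z1 ρ).subtype)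

theorem H1.mk_surjective (ρ : Representation Λ G M) : Function.Surjective (H1.mk ρ) :=
  Submodule.mkQ_surjective _

/-- The effect on cocycles of a continuous homomorphism `φ : H → G` and of a compatible linear map
`f : M → N`. -/
def Z1.map {ρ : Representation Λ G M} {ρ' : Representation Λ H N} (φ : H →ₜ* G) (f : M →ₗ[Λ] N)
    (hf : ∀ h m, f (ρ (φ h) m) = ρ' h (f m)) : Z1 ρ →ₗ[Λ] Z1 ρ' where
  toFun c := ⟨fun h => f (c.1 (φ h)), by
    refine ⟨(c.2.1.comp f).comp_continuous φ.continuous_toFun, fun σ τ => ?_⟩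
    simp only [map_mul, c.2.2, map_add, hf]⟩
  map_add' a b := by ext; simp
  map_smul' r a := by ext; simp

/-- The map `H¹(G, M) → H¹(H, N)`, `[c] ↦ [f ∘ c ∘ φ]`. -/
def H1.map {ρ : Representation Λ G M} {ρ' : Representation Λ H N} (φ : H →ₜ* G) (f : M →ₗ[Λ] N)
    (hf : ∀ h m, f (ρ (φ h) m) = ρ' h (f m)) : H1 ρ →ₗ[Λ] H1 ρ' :=
  Submodule.mapQ _ _ (Z1.map φ f hf) (by
    rintro c ⟨m, hm⟩
    refine ⟨f m, ?_⟩
    funext h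
    have := congrFun hm (φ h)
    simp only [LinearMap.pi_apply, LinearMap.sub_apply, LinearMap.id_apply,
      Submodule.subtype_apply] at this
    simp [Z1.map, ← this, hf])

end Cohomology

/-! ### Places, completions, decomposition and inertia groups -/

/-- The absolute Galois group `Gal(K̄/K)`, with the Krull topology. -/
abbrev AbsGal (K : Type*) [Field K] : Type _ := Gal(AlgebraicClosure K/K)

section Restriction

variable {K L : Type*} [Field K] [Field L] [Algebra K L]

/-- The restriction homomorphism `Gal(L̄/L) → Gal(K̄/K)` attached to an embedding `K̄ → L̄`. -/
def resHom (ι : AlgebraicClosure K →ₐ[K] AlgebraicClosure L) : AbsGal L →* AbsGal K :=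
  letI := ι.toRingHom.toAlgebra
  haveI : IsScalarTower K (AlgebraicClosure K) (AlgebraicClosure L) :=
    IsScalarTower.of_algebraMap_eq fun x => (ι.commutes x).symm
  (AlgEquiv.restrictNormalHom (F := K) (K₁ := AlgebraicClosure L) (AlgebraicClosure K)).comp
    (AlgEquiv.restrictScalarsHom K)

theorem resHom_spec (ι : AlgebraicClosure K →ₐ[K] AlgebraicClosure L) (σ : AbsGal L)
    (x : AlgebraicClosure K) : ι (resHom ι σ x) = σ (ι x) := by
  let := ι.toRingHom.toAlgebra
  have : IsScalarTower K (AlgebraicClosure K) (AlgebraicClosure L) :=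
    IsScalarTower.of_algebraMap_eq fun x => (ι.commutes x).symm
  exact AlgEquiv.restrictNormal_commutes (σ.restrictScalars K) (AlgebraicClosure K) x

/-- `resHom` as a continuous homomorphism. -/
def res (ι : AlgebraicClosure K →ₐ[K] AlgebraicClosure L) : AbsGal L →ₜ* AbsGal K where
  __ := resHom ι
  continuous_toFun := by
    refine continuous_of_continuousAt_one (resHom ι) ?_
    rw [ContinuousAt, map_one]
    intro s hs
    obtain ⟨E, hE, hEs⟩ := (krullTopology_mem_nhds_one_iff K (AlgebraicClosure K) s).1 hs
    refine (krullTopology_mem_nhds_one_iff L (AlgebraicClosure L) _).2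
      ⟨IntermediateField.adjoin L
        (Set.range fun i => ι (Module.finBasis K E i : AlgebraicClosure K)), ?_, ?_⟩
    · exact IntermediateField.finiteDimensional_adjoin
        fun x _ => Algebra.IsIntegral.isIntegral x
    · intro σ hσ
      refine hEs ?_
      rw [SetLike.mem_coe, IntermediateField.mem_fixingSubgroup_iff] at hσ ⊢
      have key : (resHom ι σ).toLinearMap ∘ₗ E.val.toLinearMap = E.val.toLinearMap := by
        refine (Module.finBasis K E).ext fun i => ι.injective ?_
        have h := hσ _ (IntermediateField.subset_adjoin L _ (Set.mem_range_self i))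
        simpa [resHom_spec] using h
      intro x hx
      exact congrArg (fun l => l ⟨x, hx⟩) key

end Restriction

section Places

variable (F : Type*) [Field F] [NumberField F]

/-- The places of a number field: finite ones and archimedean ones. -/
abbrev Place : Type _ :=
  IsDedekindDomain.HeightOneSpectrum (𝓞 F) ⊕ NumberField.InfinitePlace F

variable {F}

/-- The completion `F_v`. -/
def Place.Completion : Place F → Type _
  | .inl v => v.adicCompletion F
  | .inr w => w.Completion

instance (v : Place F) : Field v.Completion :=
  match v with
  | .inl v => inferInstanceAs (Field (v.adicCompletion F))
  | .inr w => inferInstanceAs (Field w.Completion)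

instance (v : Place F) : Algebra F v.Completion :=
  match v with
  | .inl v => inferInstanceAs (Algebra F (v.adicCompletion F))
  | .inr w => inferInstanceAs (Algebra F w.Completion)

/-- The places of `F` dividing `p`. -/
def placesOver (F : Type*) [Field F] [NumberField F] (p : ℕ) : Set (Place F) :=
  {v | ∃ w : IsDedekindDomain.HeightOneSpectrum (𝓞 F), v = .inl w ∧ (p : 𝓞 F) ∈ w.asIdeal}

/-- The inertia subgroup of `Gal(K̄/K)`, for a field `K` with a Henselian valuation ring `O`: the
automorphisms acting trivially on the residue field of the integral closure of `O` in `K̄`.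
This integral closure is a local ring, so its maximal ideal is its Jacobson radical. -/
def inertiaOf {K : Type*} [Field K] (O : ValuationSubring K) : Subgroup (AbsGal K) where
  carrier := {σ | ∀ x : integralClosure O (AlgebraicClosure K),
    ∃ y ∈ (⊥ : Ideal (integralClosure O (AlgebraicClosure K))).jacobson,
      σ (x : AlgebraicClosure K) - x = y}
  one_mem' := fun x => ⟨0, Ideal.zero_mem _, by simp⟩
  mul_mem' := by
    intro σ τ hσ hτ x
    obtain ⟨y, hy, hyx⟩ := hτ x
    obtain ⟨z, hz, hzx⟩ := hσ (x + y)
    refine ⟨z + y, Ideal.add_mem _ hz hy, ?_⟩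
    have h : τ (x : AlgebraicClosure K) = x + y := by rw [← hyx]; ring
    rw [AlgEquiv.mul_apply, h]
    push_cast at hzx ⊢
    rw [← hzx]
    ring
  inv_mem' := by
    intro σ hσ x
    have hint : σ⁻¹ (x : AlgebraicClosure K) ∈ integralClosure O (AlgebraicClosure K) :=
      x.2.map (σ⁻¹.toAlgHom.restrictScalars O)
    obtain ⟨y, hy, hyx⟩ := hσ ⟨_, hint⟩
    refine ⟨-y, Ideal.neg_mem_iff _ |>.2 hy, ?_⟩
    have h : σ (σ⁻¹ (x : AlgebraicClosure K)) = x := by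
      rw [← AlgEquiv.mul_apply, mul_inv_cancel, AlgEquiv.one_apply]
    simp only [h] at hyx
    push_cast
    rw [← hyx]
    ring

/-- The inertia subgroup `I_v` of `G_v = Gal(F̄_v/F_v)`. At an archimedean place `I_v = G_v`, as
usual. -/
def Place.inertia : (v : Place F) → Subgroup (AbsGal v.Completion)
  | .inl v => inertiaOf (v.adicCompletionIntegers F)
  | .inr _ => ⊤

variable (F) in
/-- A choice of an embedding `F̄ → F̄_v` for every place `v`; it identifies `G_v` with a
decomposition group at `v`. -/
abbrev PlaceEmbeddings : Type _ :=
  (v : Place F) → AlgebraicClosure F →ₐ[F] AlgebraicClosure v.Completion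

/-- The restriction of `res (ι v) : G_v → G_F` to a subgroup `J` of `G_v`. -/
def resSub (ι : PlaceEmbeddings F) (v : Place F) (J : Subgroup (AbsGal v.Completion)) :
    J →ₜ* AbsGal F :=
  (res (ι v)).comp ⟨J.subtype, continuous_subtype_val⟩

/-- The Galois extension `L/F` is unramified at `v`. -/
def UnramifiedAt (ι : PlaceEmbeddings F) (L : IntermediateField F (AlgebraicClosure F))
    (v : Place F) : Prop :=
  ∀ σ ∈ v.inertia, ∀ x ∈ L, res (ι v) σ x = x

/-- The Galois extension `L/F` is totally ramified at `v`: the inertia group at `v` surjects onto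
`Gal(L/F)`. -/
def TotallyRamifiedAt (ι : PlaceEmbeddings F) (L : IntermediateField F (AlgebraicClosure F))
    (v : Place F) : Prop :=
  ∀ τ : Gal(L/F), ∃ σ ∈ v.inertia, ∀ x : L, res (ι v) σ (x : AlgebraicClosure F) = τ x

/-- `F_Σ`: the maximal (Galois) extension of `F` unramified outside `S = Σ`. -/
def maxUnramifiedOutside (ι : PlaceEmbeddings F) (S : Set (Place F)) :
    IntermediateField F (AlgebraicClosure F) :=
  ⨆ L : {L : IntermediateField F (AlgebraicClosure F) //
    Normal F L ∧ ∀ v ∉ S, UnramifiedAt ι L v}, L.1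

instance (ι : PlaceEmbeddings F) (S : Set (Place F)) :
    IsGalois F (maxUnramifiedOutside ι S) :=
  haveI : Normal F (maxUnramifiedOutside ι S) :=
    IntermediateField.normal_iSup F (AlgebraicClosure F) _ (h := fun L => L.2.1)
  { }

/-- `H⁰(F_Σ/F, M)`: the invariants of `Gal(F_Σ/F) = G_F / Gal(F̄/F_Σ)` on the elements of `M`
fixed by `Gal(F̄/F_Σ)` (this is all of `M` if `M` is unramified outside `Σ`). -/
def H0Sigma {Λ M : Type*} [CommRing Λ] [AddCommGroup M] [Module Λ M] (ι : PlaceEmbeddings F)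
    (S : Set (Place F)) (ρ : Representation Λ (AbsGal F) M) :
    Submodule Λ (Representation.invariants
      (ρ.comp (maxUnramifiedOutside ι S).fixingSubgroup.subtype)) :=
  Representation.invariants
    (Representation.quotientToInvariants ρ (maxUnramifiedOutside ι S).fixingSubgroup)

end Places

/-! ### Selmer groups attached to local filtrations -/

section Selmer

variable {F : Type*} [Field F] [NumberField F] {Λ M : Type*} [CommRing Λ] [AddCommGroup M]
  [Module Λ M]

/-- A filtration `0 → F_v⁺(M) → M → F_v⁻(M) → 0` by `Λ[G_v]`-modules for every `v ∣ p`. -/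
structure LocalFiltration (ι : PlaceEmbeddings F) (p : ℕ) (ρ : Representation Λ (AbsGal F) M) where
  /-- The submodule `F_v⁺(M)`. -/
  sub : placesOver F p → Submodule Λ M
  stable : ∀ (v : placesOver F p) (σ : AbsGal (v : Place F).Completion),
    sub v ≤ (sub v).comap (ρ (res (ι v) σ))

variable {ι : PlaceEmbeddings F} {p : ℕ} {ρ : Representation Λ (AbsGal F) M}

/-- The action of `G_v` on `M / F_v⁺(M)`, for `v ∣ p`. -/
def LocalFiltration.quot (Fil : LocalFiltration ι p ρ) (v : placesOver F p) :
    Representation Λ (AbsGal (v : Place F).Completion) (M ⧸ Fil.sub v) :=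
  Representation.quotient (ρ.comp (res (ι v)).toMonoidHom) (Fil.sub v) (Fil.stable v)

/-- The localisation map `H¹(F, M) → H¹(I_v, M)`. -/
def locInertia (ι : PlaceEmbeddings F) (ρ : Representation Λ (AbsGal F) M) (v : Place F) :
    H1 ρ →ₗ[Λ] H1 (ρ.comp (resSub ι v v.inertia).toMonoidHom) :=
  H1.map (resSub ι v v.inertia) LinearMap.id fun _ _ => rfl

/-- The localisation map `H¹(F, M) → H¹(J, M / F_v⁺(M))` for `v ∣ p` and a subgroup `J` of `G_v`. -/
def locQuot (Fil : LocalFiltration ι p ρ) (v : placesOver F p)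
    (J : Subgroup (AbsGal (v : Place F).Completion)) :
    H1 ρ →ₗ[Λ] H1 ((Fil.quot v).comp J.subtype) :=
  H1.map (resSub ι v J) (Fil.sub v).mkQ fun _ _ => rfl

/-- A choice of a subgroup of `G_v` for every `v ∣ p`. -/
abbrev LocalSubgroups (F : Type*) [Field F] [NumberField F] (p : ℕ) : Type _ :=
  (v : placesOver F p) → Subgroup (AbsGal (v : Place F).Completion)

/-- The groups `I_v`, which give the Greenberg Selmer group. -/
def greenberg (F : Type*) [Field F] [NumberField F] (p : ℕ) : LocalSubgroups F p :=
  fun v => (v : Place F).inertia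

/-- The full groups `G_v`, which give the strict Greenberg Selmer group. -/
def strict (F : Type*) [Field F] [NumberField F] (p : ℕ) : LocalSubgroups F p :=
  fun _ => ⊤

/-- The Selmer group
`ker (H¹(F, M) → ∏_{v ∤ p} H¹(I_v, M) × ∏_{v ∣ p} H¹(J_v, M / F_v⁺(M)))`: the Greenberg Selmer
group `Sel(F, M)` if `J_v = I_v`, and the strict one `Sel_str(F, M)` if `J_v = G_v`. -/
def Sel (J : LocalSubgroups F p) (Fil : LocalFiltration ι p ρ) : Submodule Λ (H1 ρ) :=
  (⨅ v : {v : Place F // v ∉ placesOver F p}, LinearMap.ker (locInertia ι ρ v)) ⊓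
    ⨅ v : placesOver F p, LinearMap.ker (locQuot Fil v (J v))

variable (𝔮 : Ideal Λ)

/-- The `𝔮`-torsion submodule `M[𝔮]`. -/
abbrev tors (Λ : Type*) [CommRing Λ] (𝔮 : Ideal Λ) (M : Type*) [AddCommGroup M] [Module Λ M] :
    Submodule Λ M :=
  Submodule.torsionBySet Λ M (𝔮 : Set Λ)

/-- The Galois action on `M[𝔮]`. -/
def torsRep (ρ : Representation Λ (AbsGal F) M) : Representation Λ (AbsGal F) (tors Λ 𝔮 M) :=
  ρ.subrepresentation (tors Λ 𝔮 M) fun g x hx => by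
    simp only [Submodule.mem_comap, Submodule.mem_torsionBySet_iff] at hx ⊢
    intro a
    rw [← map_smul, hx a, map_zero]

/-- The induced filtration `F_v⁺(M[𝔮]) = M[𝔮] ∩ F_v⁺(M)`. -/
def LocalFiltration.tors (Fil : LocalFiltration ι p ρ) : LocalFiltration ι p (torsRep 𝔮 ρ) where
  sub v := (Fil.sub v).comap (SelmerControl.tors Λ 𝔮 M).subtype
  stable v σ _ hx := Fil.stable v σ hx

/-- The map `H¹(F, M[𝔮]) → H¹(F, M)` induced by the inclusion. -/
def H1tors (ρ : Representation Λ (AbsGal F) M) : H1 (torsRep 𝔮 ρ) →ₗ[Λ] H1 ρ :=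
  H1.map (ContinuousMonoidHom.id _) (tors Λ 𝔮 M).subtype fun _ _ => rfl

theorem H1tors_mem_Sel (J : LocalSubgroups F p) (Fil : LocalFiltration ι p ρ)
    {x : H1 (torsRep 𝔮 ρ)} (hx : x ∈ Sel J (Fil.tors 𝔮)) : H1tors 𝔮 ρ x ∈ Sel J Fil := by
  simp only [Sel, Submodule.mem_inf, Submodule.mem_iInf, LinearMap.mem_ker] at hx ⊢
  refine ⟨fun v => ?_, fun v => ?_⟩
  · have h := congrArg (H1.map (ρ' := ρ.comp (resSub ι v (v : Place F).inertia).toMonoidHom)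
      (ContinuousMonoidHom.id _) (tors Λ 𝔮 M).subtype fun _ _ => rfl) (hx.1 v)
    rw [map_zero] at h
    rw [← h]
    obtain ⟨c, rfl⟩ := H1.mk_surjective _ x
    rfl
  · have h := congrArg (H1.map (ρ' := (Fil.quot v).comp (J v).subtype)
      (ContinuousMonoidHom.id _)
      (Submodule.mapQ ((Fil.tors 𝔮).sub v) (Fil.sub v) (tors Λ 𝔮 M).subtype le_rfl)
      (by
        rintro g ⟨m⟩
        rfl)) (hx.2 v)
    rw [map_zero] at h
    rw [← h]
    obtain ⟨c, rfl⟩ := H1.mk_surjective _ x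
    rfl

set_option linter.unusedSectionVars false in
theorem smul_H1_torsRep {a : Λ} (ha : a ∈ 𝔮) (x : H1 (torsRep 𝔮 ρ)) : a • x = 0 := by
  obtain ⟨c, rfl⟩ := H1.mk_surjective _ x
  have : a • c = 0 := by
    ext σ
    exact (Submodule.mem_torsionBySet_iff _ _).1 (c.1 σ).2 ⟨a, ha⟩
  rw [← map_smul, this, map_zero]

/-- The canonical map `r_𝔮 : Sel(F, M[𝔮]) → Sel(F, M)[𝔮]`. -/
def controlMap (J : LocalSubgroups F p) (Fil : LocalFiltration ι p ρ) :
    Sel J (Fil.tors 𝔮) →ₗ[Λ] tors Λ 𝔮 (Sel J Fil) :=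
  LinearMap.codRestrict _
    ((H1tors 𝔮 ρ).restrict fun _ hx => H1tors_mem_Sel 𝔮 J Fil hx)
    fun x => by
      rw [Submodule.mem_torsionBySet_iff]
      rintro ⟨a, ha⟩
      rw [← map_smul]
      have : a • x = 0 := Subtype.ext (smul_H1_torsRep 𝔮 ha x.1)
      simp [this]

/-- The kernel of `r_𝔮`. -/
abbrev controlKer (J : LocalSubgroups F p) (Fil : LocalFiltration ι p ρ) : Type _ :=
  LinearMap.ker (controlMap 𝔮 J Fil)

/-- The cokernel of `r_𝔮`. -/
abbrev controlCoker (J : LocalSubgroups F p) (Fil : LocalFiltration ι p ρ) : Type _ :=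
  tors Λ 𝔮 (Sel J Fil) ⧸ LinearMap.range (controlMap 𝔮 J Fil)

end Selmer

/-! ### Pontryagin duality and pseudo-null modules -/

section Duality

/-- The discrete group `ℚ_p/ℤ_p`. -/
abbrev QpZp (p : ℕ) [Fact p.Prime] : Type :=
  ℚ_[p] ⧸ (PadicInt.subring p).toAddSubgroup

/-- The group `Hom(X, ℚ_p/ℤ_p)`: the Pontryagin dual `X^∨` of a module `X` with the discrete
topology. -/
def Dual (p : ℕ) [Fact p.Prime] (X : Type*) [AddCommGroup X] : Type _ := X →+ QpZp p

variable {p : ℕ} [Fact p.Prime] {Λ X : Type*} [CommRing Λ] [AddCommGroup X] [Module Λ X]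

instance : AddCommGroup (Dual p X) := inferInstanceAs (AddCommGroup (X →+ QpZp p))

/-- `(a • φ) x = φ (a • x)`. -/
instance : Module Λ (Dual p X) where
  smul a φ := AddMonoidHom.comp φ (DistribSMul.toAddMonoidHom X a)
  one_smul φ := AddMonoidHom.ext fun x => congrArg φ.toFun (one_smul Λ x)
  mul_smul a b φ := AddMonoidHom.ext fun x => congrArg φ.toFun (by
    change (a * b) • x = b • a • x
    rw [smul_smul, mul_comm])
  smul_zero _ := AddMonoidHom.ext fun _ => rfl
  smul_add _ _ _ := AddMonoidHom.ext fun _ => rfl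
  add_smul a b φ := AddMonoidHom.ext fun x =>
    (congrArg φ.toFun (add_smul a b x)).trans (AddMonoidHom.map_add φ _ _)
  zero_smul φ := AddMonoidHom.ext fun x =>
    (congrArg φ.toFun (zero_smul Λ x)).trans (AddMonoidHom.map_zero φ)

/-- `Λ^∨ = Hom_cont(Λ, ℚ_p/ℤ_p)`, for a topological ring `Λ`. -/
def ringDual (p : ℕ) [Fact p.Prime] (Λ : Type*) [CommRing Λ] [TopologicalSpace Λ]
    [ContinuousConstSMul Λ Λ] : Submodule Λ (Dual p Λ) where
  carrier := {φ | Continuous fun x => φ.toFun x}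
  zero_mem' := continuous_const
  add_mem' ha hb := ha.add hb
  smul_mem' a _ hb := hb.comp (continuous_const_smul a)

/-- A module is pseudo-null if its support contains only prime ideals of height at least `2`. -/
def PseudoNull (Λ X : Type*) [CommRing Λ] [AddCommGroup X] [Module Λ X] : Prop :=
  ∀ P ∈ Module.support Λ X, 2 ≤ P.asIdeal.height

end Duality

/-! ### The Iwasawa algebra of a `ℤ_p`-extension -/

section Iwasawa

/-- A `ℤ_p`-extension `F_∞/F` inside `F̄`. -/
structure ZpExtension (p : ℕ) [Fact p.Prime] (F : Type*) [Field F] where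
  /-- The field `F_∞`. -/
  field : IntermediateField F (AlgebraicClosure F)
  isGalois : IsGalois F field
  isZp : Nonempty (Gal(field/F) ≃ₜ* Multiplicative ℤ_[p])

variable {p : ℕ} [Fact p.Prime] {F : Type*} [Field F]

/-- `G_∞ = Gal(F_∞/F)`. -/
def ZpExtension.Ginf (E : ZpExtension p F) : Type _ := Gal(E.field/F)

instance (E : ZpExtension p F) : Group E.Ginf := inferInstanceAs (Group Gal(E.field/F))

instance (E : ZpExtension p F) : CommGroup E.Ginf where
  mul_comm a b := by
    obtain ⟨e⟩ := E.isZp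
    exact e.injective ((map_mul e a b).trans ((mul_comm _ _).trans (map_mul e b a).symm))

/-- The subgroup `Gal(F_∞/F_n) = G_∞ ^ (p ^ n)` of index `p ^ n` in `G_∞`. -/
def ZpExtension.layer (E : ZpExtension p F) (n : ℕ) : Subgroup E.Ginf :=
  (powMonoidHom (p ^ n) : E.Ginf →* E.Ginf).range

theorem ZpExtension.layer_succ_le (E : ZpExtension p F) (n : ℕ) :
    E.layer (n + 1) ≤ (E.layer n).comap (MonoidHom.id _) := by
  rintro _ ⟨g, rfl⟩
  exact ⟨g ^ p, by simp [← pow_mul, pow_succ']⟩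

/-- `G_n = Gal(F_n/F) = G_∞ / Gal(F_∞/F_n)`, cyclic of order `p ^ n`. -/
abbrev ZpExtension.G (E : ZpExtension p F) (n : ℕ) : Type _ := E.Ginf ⧸ E.layer n

/-- The projection `R[G_{n+1}] → R[G_n]`. -/
def ZpExtension.proj (E : ZpExtension p F) (R : Type*) [CommRing R] (n : ℕ) :
    MonoidAlgebra R (E.G (n + 1)) →ₐ[R] MonoidAlgebra R (E.G n) :=
  MonoidAlgebra.mapDomainAlgHom R R
    (QuotientGroup.map (E.layer (n + 1)) (E.layer n) (MonoidHom.id _) (E.layer_succ_le n))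

/-- The compatible families in `∏ₙ R[G_n]`. -/
def iwasawaSubalgebra (E : ZpExtension p F) (R : Type*) [CommRing R] :
    Subalgebra R (∀ n, MonoidAlgebra R (E.G n)) where
  carrier := {x | ∀ n, E.proj R n (x (n + 1)) = x n}
  mul_mem' ha hb n := by simp [ha n, hb n]
  add_mem' ha hb n := by simp [ha n, hb n]
  algebraMap_mem' r n := (E.proj R n).commutes r

/-- The Iwasawa algebra `Λ_R = R⟦G_∞⟧ = lim R[G_n]`. -/
def Iwasawa (E : ZpExtension p F) (R : Type*) [CommRing R] : Type _ := iwasawaSubalgebra E R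

variable (E : ZpExtension p F) (R : Type*) [CommRing R]

instance : CommRing (Iwasawa E R) := inferInstanceAs (CommRing (iwasawaSubalgebra E R))

instance : Algebra R (Iwasawa E R) := inferInstanceAs (Algebra R (iwasawaSubalgebra E R))

/-- The coefficients of the components of an element of `Λ_R`. -/
def Iwasawa.coeff (x : Iwasawa E R) (n : ℕ) (s : E.G n) : R := (x.1 n).coeff s

variable [IsLocalRing R]

/-- The inverse limit topology on `Λ_R`, where `R[G_n]` is a finite free module over `R` with its
`𝔪_R`-adic topology. -/
instance : TopologicalSpace (Iwasawa E R) :=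
  letI : TopologicalSpace R := (IsLocalRing.maximalIdeal R).adicTopology
  TopologicalSpace.induced (Iwasawa.coeff E R) inferInstance

instance : ContinuousConstSMul (Iwasawa E R) (Iwasawa E R) where
  continuous_const_smul a := by
    let : TopologicalSpace R := (IsLocalRing.maximalIdeal R).adicTopology
    have : NonarchimedeanRing R := (IsLocalRing.maximalIdeal R).nonarchimedean
    refine continuous_induced_rng.2 (continuous_pi fun n => continuous_pi fun s => ?_)
    have h : (fun x : Iwasawa E R => (Iwasawa.coeff E R ∘ (a • ·)) x n s) =
        fun x => ∑ t ∈ (a.1 n).coeff.support,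
          (a.1 n).coeff t * Iwasawa.coeff E R x n (t⁻¹ * s) := by
      funext x
      exact MonoidAlgebra.coeff_mul_apply_left (a.1 n) (x.1 n) s
    change Continuous fun x => _
    rw [h]
    refine continuous_finsetSum _ fun t _ => continuous_const.mul ?_
    have hc : Continuous (Iwasawa.coeff E R) := continuous_induced_dom
    exact (continuous_apply (t⁻¹ * s)).comp ((continuous_apply n).comp hc)

end Iwasawa

/-! ### The big Galois representation and its local modules -/

section Big

variable {p : ℕ} [Fact p.Prime] {F : Type*} [Field F] [NumberField F]
  {Λ T : Type*} [CommRing Λ] [TopologicalSpace Λ] [ContinuousConstSMul Λ Λ]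
  [AddCommGroup T] [Module Λ T] {ι : PlaceEmbeddings F}

/-- `𝐀 = Φ(𝐓) = 𝐓 ⊗ Λ^∨`, considered as a discrete module. -/
def BigA (p : ℕ) [Fact p.Prime] (Λ T : Type*) [CommRing Λ] [TopologicalSpace Λ]
    [ContinuousConstSMul Λ Λ] [AddCommGroup T] [Module Λ T] : Type _ :=
  T ⊗[Λ] ringDual p Λ

instance : AddCommGroup (BigA p Λ T) := inferInstanceAs (AddCommGroup (T ⊗[Λ] ringDual p Λ))

instance : Module Λ (BigA p Λ T) := inferInstanceAs (Module Λ (T ⊗[Λ] ringDual p Λ))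

/-- The Galois action on `𝐀`. -/
def repA (p : ℕ) [Fact p.Prime] (ρ : Representation Λ (AbsGal F) T) :
    Representation Λ (AbsGal F) (BigA p Λ T) where
  toFun σ := (ρ σ).rTensor (ringDual p Λ)
  map_one' := by
    rw [map_one]
    exact LinearMap.rTensor_id _ _
  map_mul' σ τ := by
    rw [map_mul]
    exact LinearMap.rTensor_mul _ _ _

/-- The filtration of `𝐀` induced by a filtration of `𝐓`: `F_v⁺(𝐀)` is the image of
`F_v⁺(𝐓) ⊗ Λ^∨`. -/
def filA {ρ : Representation Λ (AbsGal F) T} (Fil : LocalFiltration ι p ρ) :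
    LocalFiltration ι p (repA p ρ) where
  sub v := LinearMap.range ((Fil.sub v).subtype.rTensor (ringDual p Λ))
  stable v σ := by
    rintro _ ⟨x, rfl⟩
    have h : (Fil.sub v).subtype.rTensor (ringDual p Λ) ∘ₗ
        ((ρ (res (ι v) σ)).restrict (Fil.stable v σ)).rTensor (ringDual p Λ) =
        (ρ (res (ι v) σ)).rTensor (ringDual p Λ) ∘ₗ
          (Fil.sub v).subtype.rTensor (ringDual p Λ) := by
      rw [← LinearMap.rTensor_comp, ← LinearMap.rTensor_comp]
      rfl
    exact ⟨_, LinearMap.congr_fun h x⟩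

/-- The torsion submodule of the coinvariants `(X^*)_J`, where `X^* = Hom_Λ(X, Λ)`. -/
abbrev torsCoinv {J X : Type*} [Group J] [AddCommGroup X] [Module Λ X]
    (ρ : Representation Λ J X) : Submodule Λ ρ.dual.Coinvariants :=
  Submodule.torsion Λ ρ.dual.Coinvariants

/-- `C_v` for `v ∤ p`: the torsion submodule of `(𝐓^*)_{I_v}`. -/
abbrev CAway (ι : PlaceEmbeddings F) (ρ : Representation Λ (AbsGal F) T) (v : Place F) : Type _ :=
  torsCoinv (ρ.comp (resSub ι v v.inertia).toMonoidHom)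

/-- `C_v` for `v ∣ p`: the torsion submodule of `((𝐓/F_v⁺(𝐓))^*)_{J_v}`, with `J_v = I_v`, or
`J_v = G_v` in the strict case. -/
abbrev CAt (J : LocalSubgroups F p) {ρ : Representation Λ (AbsGal F) T}
    (Fil : LocalFiltration ι p ρ) (v : placesOver F p) : Type _ :=
  torsCoinv ((Fil.quot v).comp (J v).subtype)

/-- The modules `C_v/𝔮C_v`, `v ∈ S`, are pseudo-null. -/
def LocalModulesPseudoNull (J : LocalSubgroups F p) (S : Set (Place F)) (𝔮 : Ideal Λ)
    {ρ : Representation Λ (AbsGal F) T} (Fil : LocalFiltration ι p ρ) : Prop :=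
  (∀ v : placesOver F p, (v : Place F) ∈ S →
    PseudoNull Λ (CAt J Fil v ⧸ (𝔮 • ⊤ : Submodule Λ (CAt J Fil v)))) ∧
  (∀ v ∈ S, v ∉ placesOver F p →
    PseudoNull Λ (CAway ι ρ v ⧸ (𝔮 • ⊤ : Submodule Λ (CAway ι ρ v))))

/-- The Pontryagin duals of the kernel and of the cokernel of
`r_𝔮 : Sel(F, 𝐀[𝔮]) → Sel(F, 𝐀)[𝔮]` are pseudo-null. -/
def ControlPseudoNull (J : LocalSubgroups F p) (𝔮 : Ideal Λ)
    {ρ : Representation Λ (AbsGal F) T} (Fil : LocalFiltration ι p ρ) : Prop :=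
  PseudoNull Λ (Dual p (controlKer 𝔮 J (filA Fil))) ∧
  PseudoNull Λ (Dual p (controlCoker 𝔮 J (filA Fil)))

end Big

end

end SelmerControl

namespace SelmerControl

/-! ### Regular local rings are domains -/

section Regular

open IsLocalRing

/-! Pseudo-nullity is tested one prime at a time: for each prime P of height less than 2, it
suffices to find b ∉ P killing the kernel, respectively the cokernel
(`pseudoNull_dual_of_exists_smul_eq_zero`).

Everything reduces to `LiftsCoboundaries`. Let a cocycle with values in N[g] be the coboundary of
some n ∈ N. Then gn lies in the invariants W of N. If bW ⊆ gW, write bgn = gw'; now bn - w' lies in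
N[g], and its coboundary is b times the cocycle. For N = 𝐀 and G_F this kills the kernel. A class in
Sel(F, 𝐀) killed by g lifts to H¹(F, 𝐀[g]), because 𝐀 is divisible by g ≠ 0
(`exists_smul_eq_of_ne_zero`). The same principle for the local modules 𝐀 and 𝐀/F_v⁺(𝐀) shows that b
times the lift satisfies the local conditions.

To find b, dualise: W^∨/gW^∨ is the dual of W[g], and W^∨[g] is the dual of W/gW. Globally W[g] is
H⁰(𝐀[g]), so some a ∉ P kills W^∨/gW^∨, and Cayley–Hamilton turns a into b ∉ P killing W^∨[g]
(`exists_smul_torsion_eq_zero`). Locally W^∨ is the module of coinvariants of X^*, with X = 𝐓 or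
𝐓/F_v⁺(𝐓). Its g-torsion lies in C_v when g ≠ 0, and the same lemma applies to C_v
(`exists_smul_invariants_of_torsCoinv`). The elements for the finitely many v ∈ Σ are multiplied;
outside Σ inertia acts trivially.

The duality rests on Λ ≅ Λ^∨∨ (`bidual_injective`, `bidual_surjective`), which uses that Λ is
compact, Hausdorff and linearly topologized with p topologically nilpotent. That Λ is a noetherian
domain is deduced from R = Λ/(γ - 1): γ - 1 is regular, its powers divide only 0 in common, and
compactness supplies the limits. -/

theorem exists_mem_maximalIdeal_notMem {R : Type*} [CommRing R] [IsLocalRing R]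
    [IsNoetherianRing R] (h : 1 ≤ ringKrullDim R) :
    ∃ x ∈ maximalIdeal R, x ∉ maximalIdeal R ^ 2 ∧ ∀ P ∈ minimalPrimes R, x ∉ P := by
  have hmin : ∀ P ∈ minimalPrimes R, ¬ maximalIdeal R ≤ P := by
    intro P hP hle
    have : P.IsPrime := hP.1.1
    have hPm : P = maximalIdeal R := le_antisymm (le_maximalIdeal this.ne_top) hle
    have h0 : P.height = 0 := Ideal.height_eq_zero_iff.2 hP
    rw [← maximalIdeal_height_eq_ringKrullDim, ← hPm, h0] at h
    exact absurd h (by decide)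
  -- By Nakayama, 𝔪 = 𝔪² would force 𝔪 = 0, which lies in a minimal prime.
  have hsq : ¬ maximalIdeal R ≤ maximalIdeal R ^ 2 := by
    intro hle
    have hbot : maximalIdeal R = ⊥ :=
      Submodule.eq_bot_of_le_smul_of_le_jacobson_bot (maximalIdeal R) (maximalIdeal R)
        (IsNoetherian.noetherian _) (by rwa [smul_eq_mul, ← pow_two])
        (maximalIdeal_le_jacobson _)
    obtain ⟨P, hP, -⟩ := Ideal.exists_minimalPrimes_le (I := (⊥ : Ideal R)) (J := maximalIdeal R)
      bot_le
    exact hmin P hP (hbot ▸ bot_le)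
  by_contra! hcon
  have hfin : (minimalPrimes R).Finite := minimalPrimes.finite_of_isNoetherianRing R
  -- Prime avoidance; the index `none` stands for 𝔪², the one ideal that need not be prime.
  let f : Option (Ideal R) → Ideal R := fun o => o.elim (maximalIdeal R ^ 2) id
  have := (Ideal.subset_union_prime (s := insert none (hfin.toFinset.image some)) (f := f)
    none none (by
      intro i hi h1 _
      obtain ⟨P, rfl⟩ := Option.ne_none_iff_exists'.1 h1
      have : P ∈ minimalPrimes R := by simpa using hi
      exact this.1.1) (I := maximalIdeal R)).1 (by
      intro x hx
      by_cases hx2 : x ∈ maximalIdeal R ^ 2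
      · exact Set.mem_biUnion (x := none) (by simp) hx2
      · obtain ⟨P, hP, hxP⟩ := hcon x hx hx2
        exact Set.mem_biUnion (x := some P) (by simpa using hP) hxP)
  obtain ⟨i, hi, hle⟩ := this
  rcases i with _ | P
  · exact hsq hle
  · exact hmin P (by simpa using hi) hle

/-- A minimal prime P inside (x) does not contain x, so xa ∈ P forces a ∈ P. Hence P = xP, and
Nakayama gives P = 0. -/
theorem isDomain_of_isPrime_span_singleton {R : Type*} [CommRing R] [IsLocalRing R]
    [IsNoetherianRing R] {x : R} (hx : x ∈ maximalIdeal R) (hmin : ∀ P ∈ minimalPrimes R, x ∉ P)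
    (hprime : (Ideal.span {x}).IsPrime) : IsDomain R := by
  obtain ⟨P, hP, hPx⟩ := Ideal.exists_minimalPrimes_le (I := (⊥ : Ideal R)) (J := Ideal.span {x})
    bot_le
  have hPp : P.IsPrime := hP.1.1
  have hbot : P = ⊥ := by
    refine Submodule.eq_bot_of_le_smul_of_le_jacobson_bot (maximalIdeal R) P
      (IsNoetherian.noetherian _) (fun y hy => ?_) (maximalIdeal_le_jacobson _)
    obtain ⟨a, rfl⟩ := Ideal.mem_span_singleton.1 (hPx hy)
    exact Submodule.smul_mem_smul hx ((hPp.mem_or_mem hy).resolve_left (hmin P hP))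
  exact IsDomain.of_bot_isPrime R (hbp := hbot ▸ hPp)

/-- Cutting by x outside 𝔪² and outside all minimal primes removes one generator and lowers the
dimension by at most one, so induction makes (x) prime. Two inequalities replace regularity because
they pass to R/(x) directly. -/
theorem isDomain_of_card_generators_le {n : ℕ} : ∀ {R : Type*} [CommRing R] [IsLocalRing R]
    [IsNoetherianRing R] (s : Finset R), Ideal.span (s : Set R) = maximalIdeal R →
    s.card ≤ n → (n : WithBot ℕ∞) ≤ ringKrullDim R → IsDomain R := by
  induction n with
  | zero =>
    intro R _ _ _ s hs hn _
    have : s = ∅ := by simpa using hn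
    subst this
    have hf : IsField R := isField_iff_maximalIdeal_eq.2 (by simpa using hs.symm)
    exact hf.isDomain
  | succ n ih =>
    intro R _ _ _ s hs hn hdim
    classical
    obtain ⟨x, hx, hx2, hmin⟩ := exists_mem_maximalIdeal_notMem (R := R)
      (le_trans (by exact_mod_cast Nat.le_add_left 1 n) hdim)
    have : Nontrivial (R ⧸ Ideal.span {x}) := Ideal.Quotient.nontrivial_iff.2 fun h =>
      (maximalIdeal.isMaximal R).ne_top (top_le_iff.1 (h ▸ (Ideal.span_singleton_le_iff_mem _).2 hx))
    have hloc : IsLocalRing (R ⧸ Ideal.span {x}) :=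
      IsLocalRing.of_surjective' (Ideal.Quotient.mk _) Ideal.Quotient.mk_surjective
    refine isDomain_of_isPrime_span_singleton hx hmin
      ((Ideal.Quotient.isDomain_iff_prime _).1 ?_)
    obtain ⟨c, hc⟩ := Submodule.mem_span_finset'.1 (show x ∈ Ideal.span (s : Set R) from
      hs.symm ▸ hx)
    -- If no coefficient were a unit, x would lie in 𝔪². A generator with unit coefficient becomes
    -- redundant modulo x.
    obtain ⟨i, hi⟩ : ∃ i : s, IsUnit (c i) := by
      by_contra! hcon
      refine hx2 (hc ▸ Ideal.sum_mem _ fun i _ => ?_)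
      rw [pow_two]
      exact Ideal.mul_mem_mul ((mem_maximalIdeal _).2 (hcon i)) (hs ▸ Ideal.subset_span i.2)
    have hmap : (maximalIdeal R).map (Ideal.Quotient.mk (Ideal.span {x})) =
        maximalIdeal (R ⧸ Ideal.span {x}) :=
      IsLocalRing.map_maximalIdeal_of_surjective _ Ideal.Quotient.mk_surjective
    refine ih ((s.erase i).image (Ideal.Quotient.mk (Ideal.span {x}))) ?_ ?_ ?_
    · rw [← hmap, ← hs, Ideal.map_span, Finset.coe_image]
      refine le_antisymm (Ideal.span_mono (Set.image_mono (by simp))) (Ideal.span_le.2 ?_)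
      rintro _ ⟨a, ha, rfl⟩
      by_cases hai : a = i
      · have h0 : ∑ j : s, Ideal.Quotient.mk (Ideal.span {x}) (c j * j) = 0 := by
          rw [← map_sum]
          refine Ideal.Quotient.eq_zero_iff_mem.2 ?_
          simp only [smul_eq_mul] at hc
          rw [hc]
          exact Ideal.mem_span_singleton_self x
        rw [← Finset.add_sum_erase _ _ (Finset.mem_univ i), add_eq_zero_iff_eq_neg, map_mul] at h0
        rw [SetLike.mem_coe, ← Ideal.unit_mul_mem_iff_mem _ (hi.map (Ideal.Quotient.mk _)), hai, h0,
          Ideal.neg_mem_iff]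
        refine Ideal.sum_mem _ fun j hj => ?_
        rw [map_mul]
        refine Ideal.mul_mem_left _ _ (Ideal.subset_span ⟨j, ?_, rfl⟩)
        simpa [Subtype.coe_inj] using (Finset.mem_erase.1 hj).1
      · exact Ideal.subset_span ⟨a, by simpa using ⟨ha, hai⟩, rfl⟩
    · refine Finset.card_image_le.trans ?_
      rw [Finset.card_erase_of_mem i.2]
      lia
    · have := ringKrullDim_le_ringKrullDim_quotient_add_card ({x} : Finset R) (by
        simpa using (IsLocalRing.ringJacobson_eq_maximalIdeal R) ▸ hx)
      rw [Finset.card_singleton] at this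
      have h : ((n + 1 : ℕ) : WithBot ℕ∞) ≤ ringKrullDim (R ⧸ Ideal.span {x}) + 1 :=
        hdim.trans (Finset.coe_singleton x ▸ this)
      push_cast at h
      exact ENat.WithBot.add_le_add_one_right_iff.1 h

/-- A regular local ring is a domain. -/
theorem isDomain_of_isRegularLocalRing (R : Type*) [CommRing R] [IsRegularLocalRing R] :
    IsDomain R := by
  have hfg := (maximalIdeal R).fg_of_isNoetherianRing
  have hfin := Submodule.FG.finite_generators hfg
  refine isDomain_of_card_generators_le (n := (maximalIdeal R).spanFinrank) hfin.toFinset ?_ ?_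
    IsRegularLocalRing.spanFinrank_maximalIdeal.le
  · rw [Set.Finite.coe_toFinset]
    exact (maximalIdeal R).span_generators
  · rw [← Set.ncard_eq_toFinset_card _ hfin, Submodule.FG.generators_ncard hfg]

end Regular

/-! ### The group `ℚ_p/ℤ_p` -/

section QpZp

variable {p : ℕ} [Fact p.Prime]

/-- The divisible group `ℚ_p/ℤ_p` is injective. -/
theorem QpZp.baer (p : ℕ) [Fact p.Prime] : Module.Baer ℤ (QpZp p) :=
  letI : DivisibleBy ℚ_[p] ℤ :=
    { div := fun x n => x / n
      div_zero := fun x => by simp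
      div_cancel := fun x hn => by
        have : ((_ : ℤ) : ℚ_[p]) ≠ 0 := Int.cast_ne_zero.2 hn
        rw [zsmul_eq_mul, mul_div_cancel₀ _ this] }
  letI : DivisibleBy (QpZp p) ℤ :=
    Function.Surjective.divisibleBy (QuotientAddGroup.mk (s := (PadicInt.subring p).toAddSubgroup))
      (QuotientAddGroup.mk_surjective) fun _ _ => rfl
  Module.Baer.of_divisible _

theorem QpZp.exists_comp_eq {A B : Type*} [AddCommGroup A] [AddCommGroup B] (f : A →+ B)
    (hf : Function.Injective f) (g : A →+ QpZp p) : ∃ h : B →+ QpZp p, h.comp f = g :=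
  (QpZp.baer p).extension_property_addMonoidHom f hf g

/-- The class of `p⁻ᵐ`, a generator of the `p ^ m`-torsion of `ℚ_p/ℤ_p`. -/
noncomputable def QpZp.gen (p : ℕ) [Fact p.Prime] (m : ℕ) : QpZp p :=
  QuotientAddGroup.mk (((p : ℚ_[p]) ^ m)⁻¹)

theorem QpZp.pow_smul_gen (m : ℕ) : (p ^ m) • QpZp.gen p m = 0 := by
  have hp : (p : ℚ_[p]) ≠ 0 := by exact_mod_cast (Fact.out : p.Prime).ne_zero
  refine (QuotientAddGroup.eq_zero_iff _).2 ?_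
  change (p ^ m) • ((p : ℚ_[p]) ^ m)⁻¹ ∈ PadicInt.subring p
  rw [nsmul_eq_mul, Nat.cast_pow, mul_inv_cancel₀ (pow_ne_zero _ hp)]
  exact one_mem _

theorem QpZp.gen_one_ne_zero : QpZp.gen p 1 ≠ 0 := by
  intro h
  have h' : ((p : ℚ_[p]) ^ 1)⁻¹ ∈ PadicInt.subring p := (QuotientAddGroup.eq_zero_iff _).1 h
  have h2 : ‖((p : ℚ_[p]) ^ 1)⁻¹‖ ≤ 1 := h'
  rw [pow_one, norm_inv, Padic.norm_p, inv_inv] at h2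
  exact absurd h2 (not_le.2 (by exact_mod_cast (Fact.out : p.Prime).one_lt))

/-- For a representative q, the number `p ^ m * q` is a p-adic integer, and an ordinary integer
congruent to it modulo `p ^ m` is the required multiple. -/
theorem QpZp.exists_zsmul_gen_eq {m : ℕ} {x : QpZp p} (hx : (p ^ m) • x = 0) :
    ∃ n : ℤ, x = n • QpZp.gen p m := by
  have hp : (p : ℚ_[p]) ≠ 0 := by exact_mod_cast (Fact.out : p.Prime).ne_zero
  induction x using QuotientAddGroup.induction_on with
  | H q =>
  have hq : (p ^ m) • q ∈ PadicInt.subring p := (QuotientAddGroup.eq_zero_iff _).1 hx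
  let u : ℤ_[p] := ⟨(p ^ m) • q, hq⟩
  obtain ⟨z, hz⟩ := Ideal.mem_span_singleton.1 (PadicInt.appr_spec m u)
  refine ⟨u.appr m, (QuotientAddGroup.eq.2 ?_)⟩
  have hz' := congrArg (fun y : ℤ_[p] => (y : ℚ_[p])) hz
  simp only [PadicInt.coe_sub, PadicInt.coe_natCast, PadicInt.coe_mul, PadicInt.coe_pow] at hz'
  have hu : (u : ℚ_[p]) = (p : ℚ_[p]) ^ m * q := by
    change (p ^ m) • q = _
    rw [nsmul_eq_mul, Nat.cast_pow]
  rw [hu] at hz'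
  have : -q + (u.appr m : ℤ) • ((p : ℚ_[p]) ^ m)⁻¹ = ((-z : ℤ_[p]) : ℚ_[p]) := by
    rw [zsmul_eq_mul, PadicInt.coe_neg, Int.cast_natCast]
    field_simp
    linear_combination -hz'
  rw [this]
  exact (-z).2

/-- An endomorphism of `ℚ_p/ℤ_p` is multiplication by an integer on the `p ^ m`-torsion. -/
theorem QpZp.exists_zsmul_eq (χ : QpZp p →+ QpZp p) (m : ℕ) :
    ∃ n : ℤ, ∀ x, (p ^ m) • x = 0 → χ x = n • x := by
  obtain ⟨n, hn⟩ := QpZp.exists_zsmul_gen_eq (x := χ (QpZp.gen p m)) (m := m) (by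
    rw [← map_nsmul, QpZp.pow_smul_gen, map_zero])
  refine ⟨n, fun x hx => ?_⟩
  obtain ⟨k, rfl⟩ := QpZp.exists_zsmul_gen_eq hx
  rw [map_zsmul, hn, smul_comm]

/-- The characters with values in `ℚ_p/ℤ_p` separate the elements of `p`-power order. -/
theorem QpZp.exists_ne_zero {X : Type*} [AddCommGroup X] {x : X} (hx : x ≠ 0) {n : ℕ}
    (hn : (p ^ n) • x = 0) : ∃ χ : X →+ QpZp p, χ x ≠ 0 := by
  induction n generalizing x with
  | zero => simp at hn; exact absurd hn hx
  | succ n ih =>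
    -- When p kills x, send x to `gen p 1` and extend by injectivity of ℚ_p/ℤ_p; otherwise descend
    -- to p • x.
    by_cases hpx : p • x = 0
    · let f : ZMod p →+ X := ZMod.lift p ⟨(zmultiplesHom X) x, by simpa using hpx⟩
      let g : ZMod p →+ QpZp p := ZMod.lift p ⟨(zmultiplesHom (QpZp p)) (QpZp.gen p 1), by
        simpa using QpZp.pow_smul_gen (p := p) 1⟩
      have h1 : f 1 = x := by simpa using ZMod.lift_coe p ⟨(zmultiplesHom X) x, by simpa using hpx⟩ (1 : ℤ)
      have h2 : g 1 = QpZp.gen p 1 := by 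
        simpa using ZMod.lift_coe p ⟨(zmultiplesHom (QpZp p)) (QpZp.gen p 1), by
          simpa using QpZp.pow_smul_gen (p := p) 1⟩ (1 : ℤ)
      have hf : Function.Injective f := by
        rw [injective_iff_map_eq_zero]
        intro a ha
        by_contra ha0
        refine hx ?_
        rw [← h1, ← inv_mul_cancel₀ ha0]
        obtain ⟨k, hk⟩ := ZMod.intCast_surjective (a⁻¹)
        rw [← hk, ← zsmul_eq_mul, map_zsmul, ha, smul_zero]
      obtain ⟨χ, hχ⟩ := QpZp.exists_comp_eq f hf g
      refine ⟨χ, ?_⟩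
      rw [← h1, ← AddMonoidHom.comp_apply, hχ, h2]
      exact QpZp.gen_one_ne_zero
    · obtain ⟨χ, hχ⟩ := ih hpx (by rw [smul_smul, ← pow_succ, hn])
      exact ⟨χ, fun h => hχ (by rw [map_nsmul, h, smul_zero])⟩

/-- Duality for finite families in the `p ^ m`-torsion of `ℚ_p/ℤ_p`. -/
theorem QpZp.mem_of_forall_sum_eq_zero {I : Type*} [Fintype I] {m : ℕ}
    (H : AddSubgroup (I → QpZp p)) (hH : ∀ h ∈ H, ∀ i, (p ^ m) • h i = 0) (y : I → QpZp p)
    (hy : ∀ i, (p ^ m) • y i = 0)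
    (hn : ∀ n : I → ℤ, (∀ h ∈ H, ∑ i, n i • h i = 0) → ∑ i, n i • y i = 0) : y ∈ H := by
  classical
  by_contra hyH
  -- A character trivial on H but not on y acts on the `p ^ m`-torsion of the i-th coordinate as an
  -- integer `n i`; these integers contradict `hn`.
  obtain ⟨χ, hχ⟩ := QpZp.exists_ne_zero (p := p) (n := m) (X := (I → QpZp p) ⧸ H)
    (x := QuotientAddGroup.mk y) (by rwa [Ne, QuotientAddGroup.eq_zero_iff]) (by
      rw [← QuotientAddGroup.mk_nsmul, show (p ^ m) • y = 0 from funext hy]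
      rfl)
  choose n hn' using fun i => QpZp.exists_zsmul_eq
    ((χ.comp (QuotientAddGroup.mk' H)).comp (AddMonoidHom.single (fun _ : I => QpZp p) i)) m
  have key : ∀ h : I → QpZp p, (∀ i, (p ^ m) • h i = 0) →
      χ (QuotientAddGroup.mk h) = ∑ i, n i • h i := by
    intro h hh
    have : h = ∑ i, Pi.single i (h i) := (Finset.univ_sum_single h).symm
    conv_lhs => rw [this]
    change (χ.comp (QuotientAddGroup.mk' H)) _ = _
    rw [map_sum]
    exact Finset.sum_congr rfl fun i _ => hn' i (h i) (hh i)
  refine hχ ((key y hy).trans (hn n fun h hh => ?_))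
  rw [← key h (hH h hh), (QuotientAddGroup.eq_zero_iff h).2 hh, map_zero]

end QpZp

/-! ### Pontryagin duality over a compact ring -/

section DualBasics

variable {p : ℕ} [Fact p.Prime] {Λ X : Type*} [CommRing Λ] [AddCommGroup X] [Module Λ X]

instance : FunLike (Dual p X) X (QpZp p) := inferInstanceAs (FunLike (X →+ QpZp p) X (QpZp p))

instance : AddMonoidHomClass (Dual p X) X (QpZp p) :=
  inferInstanceAs (AddMonoidHomClass (X →+ QpZp p) X (QpZp p))

theorem Dual.ext {φ ψ : Dual p X} (h : ∀ x, φ x = ψ x) : φ = ψ := DFunLike.ext _ _ h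

theorem Dual.smul_apply (a : Λ) (φ : Dual p X) (x : X) : (a • φ) x = φ (a • x) := rfl

/-- Characters separate p-power torsion in X/U. Membership in a submodule is tested this way
throughout. -/
theorem Dual.exists_apply_ne_zero (htors : ∀ x : X, ∃ n : ℕ, (p ^ n) • x = 0) (U : Submodule Λ X)
    {x : X} (hx : x ∉ U) : ∃ χ : Dual p X, (∀ u ∈ U, χ u = 0) ∧ χ x ≠ 0 := by
  obtain ⟨n, hn⟩ := htors x
  obtain ⟨χ, hχ⟩ := QpZp.exists_ne_zero (p := p) (x := U.mkQ x) (by simpa using hx) (n := n)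
    (by rw [← map_nsmul, hn, map_zero])
  refine ⟨(χ.comp U.mkQ.toAddMonoidHom : X →+ QpZp p), fun u hu => ?_, hχ⟩
  change χ (U.mkQ u) = 0
  rw [Submodule.mkQ_apply, (Submodule.Quotient.mk_eq_zero U).2 hu, map_zero]

theorem Dual.exists_extension {Y : Type*} [AddCommGroup Y] [Module Λ Y] (f : X →ₗ[Λ] Y)
    (χ : Dual p X) (h : ∀ x, f x = 0 → χ x = 0) : ∃ χ' : Dual p Y, ∀ x, χ' (f x) = χ x := by
  let e : X ⧸ LinearMap.ker f →+ Y := ((LinearMap.ker f).liftQ f le_rfl).toAddMonoidHom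
  have he : Function.Injective e := by
    have := LinearMap.ker_eq_bot.1 (Submodule.ker_liftQ_eq_bot (LinearMap.ker f) f le_rfl le_rfl)
    exact this
  obtain ⟨χ', hχ'⟩ := QpZp.exists_comp_eq e he
    (QuotientAddGroup.lift (LinearMap.ker f).toAddSubgroup χ fun x hx => h x hx)
  exact ⟨χ', fun x => DFunLike.congr_fun hχ' ((LinearMap.ker f).mkQ x)⟩

end DualBasics

/-! ### Biduality for the ring `Λ` -/

section Biduality

open Filter Topology

variable {p : ℕ} [Fact p.Prime] {Λ : Type*} [CommRing Λ] [TopologicalSpace Λ]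

instance (p : ℕ) [Fact p.Prime] : DiscreteTopology (QpZp p) := by
  refine QuotientAddGroup.discreteTopology ?_
  change IsOpen {x : ℚ_[p] | ‖x‖ ≤ 1}
  have : {x : ℚ_[p] | ‖x‖ ≤ 1} = Metric.closedBall 0 1 := by ext; simp
  rw [this]
  exact IsUltrametricDist.isOpen_closedBall 0 one_ne_zero

variable [IsTopologicalRing Λ]

theorem mem_ringDual_of_isOpen {U : Ideal Λ} (hU : IsOpen (U : Set Λ)) {φ : Dual p Λ}
    (h : ∀ x ∈ U, φ x = 0) : φ ∈ ringDual p Λ := by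
  refine continuous_of_continuousAt_zero (φ : Λ →+ QpZp p) ?_
  rw [ContinuousAt, map_zero, nhds_discrete (QpZp p), tendsto_pure]
  exact Filter.mem_of_superset (hU.mem_nhds U.zero_mem) h

variable (p Λ) in
/-- The canonical map from `Λ` to its Pontryagin bidual. -/
noncomputable def bidual : Λ →ₗ[Λ] Dual p (ringDual p Λ) where
  toFun x := ((AddMonoidHom.eval x).comp (ringDual p Λ).subtype.toAddMonoidHom :
    ringDual p Λ →+ QpZp p)
  map_add' x y := Dual.ext fun φ => map_add φ.1 x y
  map_smul' _ _ := Dual.ext fun _ => rfl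

theorem bidual_apply (x : Λ) (φ : ringDual p Λ) : bidual p Λ x φ = φ.1 x := rfl

variable [IsLinearTopology Λ Λ]

theorem exists_isOpen_ideal_of_mem_ringDual {φ : Dual p Λ} (hφ : φ ∈ ringDual p Λ) :
    ∃ U : Ideal Λ, IsOpen (U : Set Λ) ∧ ∀ x ∈ U, φ x = 0 := by
  have h : {x : Λ | φ x = 0} ∈ 𝓝 (0 : Λ) :=
    ((isOpen_discrete ({0} : Set (QpZp p))).preimage hφ).mem_nhds (map_zero φ)
  obtain ⟨U, hU, hUs⟩ := (IsLinearTopology.hasBasis_open_ideal (R := Λ)).mem_iff.1 h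
  exact ⟨U, hU, fun x hx => hUs hx⟩

theorem ringDual_isTorsion (hp : Tendsto (fun n => (p : Λ) ^ n) atTop (𝓝 0)) (φ : ringDual p Λ) :
    ∃ n : ℕ, (p ^ n) • φ = 0 := by
  obtain ⟨U, hU, hφ⟩ := exists_isOpen_ideal_of_mem_ringDual φ.2
  obtain ⟨n, hn⟩ := (hp.eventually (hU.mem_nhds U.zero_mem)).exists
  refine ⟨n, ?_⟩
  rw [← Nat.cast_smul_eq_nsmul Λ]
  refine Subtype.ext (Dual.ext fun x => ?_)
  change φ.1 (((p ^ n : ℕ) : Λ) • x) = 0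
  refine hφ _ ?_
  rw [Nat.cast_pow]
  exact U.mul_mem_right _ hn

/-- A nonzero x avoids some open ideal U and has p-power order in Λ/U, so a character of Λ/U,
automatically continuous on Λ, detects it. -/
theorem bidual_injective [T2Space Λ] (hp : Tendsto (fun n => (p : Λ) ^ n) atTop (𝓝 0)) :
    Function.Injective (bidual p Λ) := by
  rw [injective_iff_map_eq_zero]
  intro x hx
  by_contra hx0
  obtain ⟨U, hU, hUx⟩ := (IsLinearTopology.hasBasis_open_ideal (R := Λ)).mem_iff.1
    (isOpen_compl_singleton.mem_nhds (Ne.symm hx0) : ({x}ᶜ : Set Λ) ∈ 𝓝 0)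
  have hxU : x ∉ U := fun h => hUx h rfl
  obtain ⟨n, hn⟩ := (hp.eventually (hU.mem_nhds U.zero_mem)).exists
  obtain ⟨χ, hχ⟩ := QpZp.exists_ne_zero (p := p) (x := U.mkQ x) (by
    rwa [Ne, Submodule.mkQ_apply, Submodule.Quotient.mk_eq_zero]) (n := n) (by
    rw [← Nat.cast_smul_eq_nsmul Λ, ← map_smul, Submodule.mkQ_apply,
      Submodule.Quotient.mk_eq_zero, Nat.cast_pow]
    exact U.mul_mem_right _ hn)
  refine hχ ?_
  let φ : Dual p Λ := (χ.comp U.mkQ.toAddMonoidHom : Λ →+ QpZp p)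
  have hφ : φ ∈ ringDual p Λ := mem_ringDual_of_isOpen hU fun u hu => by
    change χ (U.mkQ u) = 0
    rw [Submodule.mkQ_apply, (Submodule.Quotient.mk_eq_zero U).2 hu, map_zero]
  exact DFunLike.congr_fun hx (⟨φ, hφ⟩ : ringDual p Λ)

/-- For each φ the points x with φ(x) = ψ(φ) form a closed set. Finite duality in ℚ_p/ℤ_p shows that
finitely many of these sets meet, and compactness yields a common point. -/
theorem bidual_surjective [CompactSpace Λ]
    (hp : Tendsto (fun n => (p : Λ) ^ n) atTop (𝓝 0)) :
    Function.Surjective (bidual p Λ) := by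
  classical
  intro ψ
  have hne := isCompact_univ.inter_iInter_nonempty
    (fun φ : ringDual p Λ => {x : Λ | φ.1 x = ψ φ})
    (fun φ => (isClosed_discrete ({ψ φ} : Set (QpZp p))).preimage φ.2) (by
      intro u
      let H : Λ →+ (u → QpZp p) := AddMonoidHom.mk' (fun x φ => φ.1.1 x) fun x y => by
        funext φ
        exact map_add φ.1.1 x y
      choose m hm using ringDual_isTorsion hp
      have hm' : ∀ φ : u, (p ^ (∑ φ : u, m φ)) • φ.1 = 0 := by
        intro φ
        rw [← Finset.add_sum_erase _ _ (Finset.mem_univ φ), pow_add, mul_comm, mul_smul, hm,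
          smul_zero]
      obtain ⟨x, hx⟩ := QpZp.mem_of_forall_sum_eq_zero (m := ∑ φ : u, m φ) H.range (by
        rintro _ ⟨x, rfl⟩ φ
        have := congrArg (bidual p Λ x) (hm' φ)
        rwa [map_nsmul, map_zero] at this) (fun φ => ψ φ) (fun φ => by
          rw [← map_nsmul, hm', map_zero]) (by
        intro n hn
        have h0 : ∑ φ : u, n φ • φ.1 = 0 := by
          refine Subtype.ext (Dual.ext fun x => ?_)
          have h1 := hn _ ⟨x, rfl⟩
          have h2 : bidual p Λ x (∑ φ : u, n φ • φ.1) = ∑ φ : u, n φ • φ.1.1 x := by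
            simp only [map_sum, map_zsmul, bidual_apply]
          exact h2.trans h1
        have := congrArg ψ h0
        simpa only [map_sum, map_zsmul, map_zero] using this)
      refine ⟨x, Set.mem_univ _, ?_⟩
      simp only [Set.mem_iInter]
      exact fun φ hφ => congrFun hx ⟨φ, hφ⟩)
  obtain ⟨x, -, hx⟩ := hne
  rw [Set.mem_iInter] at hx
  exact ⟨x, Dual.ext hx⟩

end Biduality

/-! ### Modules killed by an element outside a prime -/

section Annihilation

variable {Λ Y : Type*} [CommRing Λ] [AddCommGroup Y] [Module Λ Y]

/-- Finite generation turns absence of P from the support into one annihilator outside P. -/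
theorem PseudoNull.exists_smul_eq_zero [Module.Finite Λ Y] (h : PseudoNull Λ Y)
    {P : PrimeSpectrum Λ} (hP : P.asIdeal.height < 2) :
    ∃ a ∉ P.asIdeal, ∀ y : Y, a • y = 0 := by
  have hs : P ∉ Module.support Λ Y := fun hmem => absurd (h P hmem) (not_le.2 hP)
  rw [Module.mem_support_iff_of_finite, SetLike.not_le_iff_exists] at hs
  obtain ⟨a, ha, haP⟩ := hs
  exact ⟨a, haP, fun y => Module.mem_annihilator.1 ha y⟩

theorem pseudoNull_of_exists_smul_eq_zero
    (h : ∀ P : PrimeSpectrum Λ, P.asIdeal.height < 2 → ∃ b ∉ P.asIdeal, ∀ y : Y, b • y = 0) :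
    PseudoNull Λ Y := by
  intro P hP
  by_contra hlt
  obtain ⟨b, hb, hby⟩ := h P (not_le.1 hlt)
  exact (Module.notMem_support_iff'.2 fun y => ⟨b, hb, hby y⟩) hP

/-- If `Y/gY` is killed by an element outside the prime `P`, then so is `Y[g]`. -/
theorem exists_smul_torsion_eq_zero [Module.Finite Λ Y] (P : Ideal Λ) [P.IsPrime] {a g : Λ}
    (ha : a ∉ P) (h : ∀ y : Y, ∃ z : Y, a • y = g • z) :
    ∃ b ∉ P, ∀ y : Y, g • y = 0 → b • y = 0 := by
  by_cases hg : g ∈ P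
  swap
  · exact ⟨g, hg, fun _ hy => hy⟩
  -- Cayley–Hamilton for multiplication by a, which maps Y into gY. The lower coefficients of the
  -- monic q lie in (g) ⊆ P, so q(a) is a power of a modulo P, and q(a) kills Y.
  obtain ⟨q, hq, hdeg, hcoeff, hq0⟩ :=
    LinearMap.exists_monic_and_natDegree_eq_and_coeff_mem_pow_and_aeval_eq_zero Λ
      (LinearMap.lsmul Λ Y a) (Ideal.span {g}) (by
        rintro _ ⟨y, rfl⟩
        obtain ⟨z, hz⟩ := h y
        rw [LinearMap.lsmul_apply, hz]
        exact Submodule.smul_mem_smul (Ideal.mem_span_singleton_self g) trivial)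
  refine ⟨q.eval a, fun hmem => ?_, fun y _ => ?_⟩
  · refine ha (Ideal.IsPrime.mem_of_pow_mem ‹_› q.natDegree ?_)
    rw [Polynomial.eval_eq_sum_range, Finset.sum_range_succ, hq.coeff_natDegree, one_mul] at hmem
    refine (Ideal.add_mem_iff_right _ (Ideal.sum_mem _ fun k hk => ?_)).1 hmem
    refine Ideal.mul_mem_right _ _ (Ideal.pow_le_self (Nat.sub_ne_zero_of_lt
      (Finset.mem_range.1 hk)) ?_)
    exact Ideal.pow_right_mono ((Ideal.span_singleton_le_iff_mem _).2 hg) _ (hcoeff k)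
  · have h1 : Polynomial.aeval (LinearMap.lsmul Λ Y a) q = LinearMap.lsmul Λ Y (q.eval a) := by
      have := Polynomial.aeval_algebraMap_apply (A := Λ) (Module.End Λ Y) a q
      rw [Polynomial.coe_aeval_eq_eval] at this
      exact this
    rw [h1] at hq0
    exact LinearMap.congr_fun hq0 y

end Annihilation

/-! ### The dual of `X ⊗ Λ^∨` -/

section Tensor

open Filter Topology

variable {p : ℕ} [Fact p.Prime] {Λ : Type*} [CommRing Λ] [TopologicalSpace Λ]
  [IsTopologicalRing Λ] {X : Type*} [AddCommGroup X] [Module Λ X]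

variable (p) in
/-- The map `X ⊗ Λ^∨ → Λ^∨` attached to a linear form on `X`. -/
noncomputable def contract (f : X →ₗ[Λ] Λ) : X ⊗[Λ] ringDual p Λ →ₗ[Λ] ringDual p Λ :=
  (TensorProduct.lid Λ (ringDual p Λ)).toLinearMap ∘ₗ f.rTensor (ringDual p Λ)

theorem contract_tmul (f : X →ₗ[Λ] Λ) (x : X) (φ : ringDual p Λ) :
    contract p f (x ⊗ₜ φ) = f x • φ := by
  simp [contract]

theorem contract_add (f g : X →ₗ[Λ] Λ) : contract p (f + g) = contract p f + contract p g := by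
  simp [contract, LinearMap.rTensor_add, LinearMap.comp_add]

theorem contract_smul (a : Λ) (f : X →ₗ[Λ] Λ) : contract p (a • f) = a • contract p f := by
  simp [contract, LinearMap.rTensor_smul, LinearMap.comp_smul]

theorem contract_comp (f : X →ₗ[Λ] Λ) (u : X →ₗ[Λ] X) (n : X ⊗[Λ] ringDual p Λ) :
    contract p (f ∘ₗ u) n = contract p f (u.rTensor _ n) := by
  simp [contract, LinearMap.rTensor_comp]

variable (p) in
/-- The pairing of `X^*` with `X ⊗ Λ^∨`: `(f, x ⊗ φ) ↦ φ (f x)`. -/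
noncomputable def pairing : (X →ₗ[Λ] Λ) →ₗ[Λ] Dual p (X ⊗[Λ] ringDual p Λ) where
  toFun f := (((bidual p Λ 1 : ringDual p Λ →+ QpZp p)).comp (contract p f).toAddMonoidHom :
    X ⊗[Λ] ringDual p Λ →+ QpZp p)
  map_add' f g := Dual.ext fun n => by
    change bidual p Λ 1 (contract p (f + g) n) = bidual p Λ 1 _ + bidual p Λ 1 _
    rw [contract_add, LinearMap.add_apply, map_add]
    rfl
  map_smul' a f := Dual.ext fun n => by
    change bidual p Λ 1 (contract p (a • f) n) = bidual p Λ 1 (contract p f (a • n))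
    rw [contract_smul, LinearMap.smul_apply, map_smul (contract p f)]

theorem pairing_apply (f : X →ₗ[Λ] Λ) (n : X ⊗[Λ] ringDual p Λ) :
    pairing p f n = (contract p f n).1 1 := rfl

theorem pairing_smul_apply (f : X →ₗ[Λ] Λ) (a : Λ) (n : X ⊗[Λ] ringDual p Λ) :
    pairing p f (a • n) = (contract p f n).1 a := by
  rw [pairing_apply, map_smul]
  change (contract p f n).1 (a • (1 : Λ)) = _
  rw [smul_eq_mul, mul_one]

theorem pairing_tmul (f : X →ₗ[Λ] Λ) (x : X) (φ : ringDual p Λ) :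
    pairing p f (x ⊗ₜ φ) = φ.1 (f x) := by
  rw [pairing_apply, contract_tmul]
  change φ.1 (f x • (1 : Λ)) = _
  rw [smul_eq_mul, mul_one]

variable [IsLinearTopology Λ Λ]

theorem tensor_isTorsion (hp : Tendsto (fun n => (p : Λ) ^ n) atTop (𝓝 0))
    (n : X ⊗[Λ] ringDual p Λ) : ∃ k : ℕ, (p ^ k) • n = 0 := by
  induction n with
  | zero => exact ⟨0, smul_zero _⟩
  | tmul x φ =>
    obtain ⟨k, hk⟩ := ringDual_isTorsion hp φ
    exact ⟨k, by rw [← TensorProduct.tmul_smul, hk, TensorProduct.tmul_zero]⟩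
  | add a b ha hb =>
    obtain ⟨k, hk⟩ := ha
    obtain ⟨l, hl⟩ := hb
    refine ⟨k + l, ?_⟩
    rw [smul_add, pow_add, mul_smul, smul_comm, hk, smul_zero, mul_smul, hl, smul_zero, add_zero]

theorem pairing_injective [T2Space Λ] (hp : Tendsto (fun n => (p : Λ) ^ n) atTop (𝓝 0)) :
    Function.Injective (pairing p : (X →ₗ[Λ] Λ) →ₗ[Λ] _) := by
  rw [injective_iff_map_eq_zero]
  intro f hf
  ext x
  refine (injective_iff_map_eq_zero _).1 (bidual_injective hp) _ (Dual.ext fun φ => ?_)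
  rw [bidual_apply, ← pairing_tmul, hf]
  rfl

variable [CompactSpace Λ] [T2Space Λ]

/-- By adjunction, a character of X ⊗ Λ^∨ is a linear map from X to the dual of Λ^∨, which is Λ by
biduality. -/
theorem pairing_surjective (hp : Tendsto (fun n => (p : Λ) ^ n) atTop (𝓝 0)) :
    Function.Surjective (pairing p : (X →ₗ[Λ] Λ) →ₗ[Λ] _) := by
  intro χ
  let e := LinearEquiv.ofBijective (bidual p Λ) ⟨bidual_injective hp, bidual_surjective hp⟩
  let ψ : X →ₗ[Λ] Dual p (ringDual p Λ) :=
    { toFun := fun x => (AddMonoidHom.comp χ (TensorProduct.mk Λ X (ringDual p Λ) x).toAddMonoidHom :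
        ringDual p Λ →+ QpZp p)
      map_add' := fun x y => Dual.ext fun φ => by
        change χ ((x + y) ⊗ₜ φ) = χ (x ⊗ₜ φ) + χ (y ⊗ₜ φ)
        rw [TensorProduct.add_tmul, map_add]
      map_smul' := fun a x => Dual.ext fun φ => by
        change χ ((a • x) ⊗ₜ φ) = χ (x ⊗ₜ (a • φ))
        rw [TensorProduct.smul_tmul] }
  refine ⟨e.symm.toLinearMap ∘ₗ ψ, Dual.ext fun n => ?_⟩
  induction n with
  | zero => rw [map_zero, map_zero]
  | add a b ha hb => rw [map_add, map_add, ha, hb]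
  | tmul x φ =>
    rw [pairing_tmul, ← bidual_apply]
    exact DFunLike.congr_fun (e.apply_symm_apply (ψ x)) φ

/-- For a domain `Λ`, the module `X ⊗ Λ^∨` is divisible by the nonzero elements of `Λ`. -/
theorem exists_smul_eq_of_ne_zero [IsDomain Λ]
    (hp : Tendsto (fun n => (p : Λ) ^ n) atTop (𝓝 0)) {g : Λ} (hg : g ≠ 0) (n : X ⊗[Λ] ringDual p Λ) :
    ∃ n', g • n' = n := by
  -- The dual of Λ^∨/gΛ^∨ is Λ[g], which is zero in a domain.
  have hdiv : ∀ φ : ringDual p Λ, ∃ φ', g • φ' = φ := by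
    intro φ
    by_contra hφ
    obtain ⟨χ, hχ, hχφ⟩ := Dual.exists_apply_ne_zero (ringDual_isTorsion hp)
      (LinearMap.range (LinearMap.lsmul Λ (ringDual p Λ) g)) (x := φ) hφ
    obtain ⟨x, rfl⟩ := bidual_surjective hp χ
    have h0 : bidual p Λ (g • x) = 0 := by
      rw [map_smul]
      exact Dual.ext fun φ' => hχ _ ⟨φ', rfl⟩
    rw [← map_zero (bidual p Λ)] at h0
    have hx : x = 0 := (smul_eq_zero.1 (bidual_injective hp h0)).resolve_left hg
    exact hχφ (by rw [hx, map_zero]; rfl)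
  induction n with
  | zero => exact ⟨0, smul_zero _⟩
  | tmul x φ =>
    obtain ⟨φ', rfl⟩ := hdiv φ
    exact ⟨x ⊗ₜ φ', by rw [TensorProduct.tmul_smul]⟩
  | add a b ha hb =>
    obtain ⟨a', rfl⟩ := ha
    obtain ⟨b', rfl⟩ := hb
    exact ⟨a' + b', smul_add _ _ _⟩

/-- The double annihilator of a finitely generated submodule of `X^*`. -/
theorem mem_of_forall_pairing_eq_zero (hp : Tendsto (fun n => (p : Λ) ^ n) atTop (𝓝 0))
    {D : Submodule Λ (X →ₗ[Λ] Λ)} (hD : D.FG) {f : X →ₗ[Λ] Λ}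
    (h : ∀ n, (∀ d ∈ D, contract p d n = 0) → pairing p f n = 0) : f ∈ D := by
  obtain ⟨s, rfl⟩ := hD
  -- The character of f depends only on the contractions against the generators, so it extends to a
  -- finite power of Λ^∨. By biduality the extension is a tuple c in Λ, the coefficients of f.
  obtain ⟨χ, hχ⟩ := Dual.exists_extension
    (LinearMap.pi fun d : s => contract (p := p) (d : X →ₗ[Λ] Λ)) (pairing p f) (by
      intro n hn
      refine h n fun d hd => ?_
      induction hd using Submodule.span_induction with
      | mem d hd => exact congrFun hn ⟨d, hd⟩
      | zero => simp [contract]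
      | add a b _ _ ha hb => rw [contract_add, LinearMap.add_apply, ha, hb, add_zero]
      | smul a d _ hd => rw [contract_smul, LinearMap.smul_apply, hd, smul_zero])
  classical
  choose c hc using fun d : s => bidual_surjective hp
    (AddMonoidHom.comp χ (AddMonoidHom.single (fun _ : s => ringDual p Λ) d) :
      ringDual p Λ →+ QpZp p)
  have hf : f = ∑ d : s, c d • (d : X →ₗ[Λ] Λ) := by
    refine pairing_injective hp (Dual.ext fun n => ?_)
    rw [← hχ n, ← Finset.univ_sum_single (LinearMap.pi _ n), map_sum, map_sum]
    have hsum : ∀ (t : Finset s) (F : s → Dual p (X ⊗[Λ] ringDual p Λ)),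
        (∑ d ∈ t, F d) n = ∑ d ∈ t, F d n := by
      intro t F
      induction t using Finset.induction_on with
      | empty => rfl
      | insert d t hd ih => rw [Finset.sum_insert hd, Finset.sum_insert hd, ← ih]; rfl
    rw [hsum]
    refine Finset.sum_congr rfl fun d _ => ?_
    rw [map_smul, Dual.smul_apply, pairing_smul_apply, ← bidual_apply, hc]
    rfl
  rw [hf]
  exact Submodule.sum_mem _ fun d _ => Submodule.smul_mem _ _ (Submodule.subset_span d.2)

end Tensor

/-! ### Divisibility of invariants up to an element outside a prime -/

section Invariants

open Filter Topology

variable {p : ℕ} [Fact p.Prime] {Λ : Type*} [CommRing Λ]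

/-- If `bW ⊆ gW` for the invariants `W` of `N`, then `b` times a coboundary killed by `g` is the
coboundary of an element killed by `g`. -/
theorem exists_torsion_coboundary {J N : Type*} [Group J] [AddCommGroup N] [Module Λ N]
    (τ : Representation Λ J N) {b g : Λ}
    (h : ∀ w ∈ τ.invariants, ∃ w' ∈ τ.invariants, b • w = g • w') {n : N}
    (hn : ∀ σ, g • (τ σ n - n) = 0) :
    ∃ n', g • n' = 0 ∧ ∀ σ, τ σ n' - n' = b • (τ σ n - n) := by
  obtain ⟨w', hw', hb⟩ := h (g • n) fun σ => by
    rw [map_smul, ← sub_eq_zero, ← smul_sub, hn]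
  refine ⟨b • n - w', by rw [smul_sub, smul_comm, hb, sub_self], fun σ => ?_⟩
  rw [map_sub, map_smul, hw' σ, smul_sub]
  abel

theorem Dual.finite_of_injective {U N : Type*} [AddCommGroup U] [Module Λ U] [AddCommGroup N]
    [Module Λ N] [Module.Finite Λ (Dual p N)] (i : U →ₗ[Λ] N) (hi : Function.Injective i) :
    Module.Finite Λ (Dual p U) := by
  let r : Dual p N →ₗ[Λ] Dual p U :=
    { toFun := fun χ => (AddMonoidHom.comp χ i.toAddMonoidHom : U →+ QpZp p)
      map_add' := fun _ _ => rfl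
      map_smul' := fun a χ => Dual.ext fun u => congrArg χ (map_smul i a u).symm }
  refine Module.Finite.of_surjective r fun χ => ?_
  obtain ⟨χ', hχ'⟩ := Dual.exists_extension i χ fun x hx => by
    rw [(injective_iff_map_eq_zero i).1 hi x hx, map_zero]
  exact ⟨χ', Dual.ext hχ'⟩

/-- Put Y = W^∨. Then Y/gY is the dual of W[g] ≅ V and is killed outside P;
`exists_smul_torsion_eq_zero` passes to Y[g], the dual of W/gW. -/
theorem exists_smul_invariants_of_dual {N : Type*} [AddCommGroup N] [Module Λ N]
    (htors : ∀ n : N, ∃ k : ℕ, (p ^ k) • n = 0) [IsNoetherianRing Λ] [Module.Finite Λ (Dual p N)]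
    (W : Submodule Λ N) {V : Type*} [AddCommGroup V] [Module Λ V] (j : V →ₗ[Λ] N)
    (hj : Function.Injective j) {g : Λ} (hV : ∀ n, n ∈ LinearMap.range j ↔ n ∈ W ∧ g • n = 0)
    (hpn : PseudoNull Λ (Dual p V)) {P : PrimeSpectrum Λ} (hP : P.asIdeal.height < 2) :
    ∃ b ∉ P.asIdeal, ∀ w ∈ W, ∃ w' ∈ W, b • w = g • w' := by
  have := Dual.finite_of_injective (p := p) j hj
  have := Dual.finite_of_injective (p := p) W.subtype W.subtype_injective
  obtain ⟨a, ha, haV⟩ := hpn.exists_smul_eq_zero hP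
  obtain ⟨b, hb, hbW⟩ := exists_smul_torsion_eq_zero (Y := Dual p W) P.asIdeal ha (g := g) (by
    intro χ
    -- As a kills V^∨, the character a • χ vanishes on W[g] and hence factors through multiplication
    -- by g.
    obtain ⟨χ', hχ'⟩ := Dual.exists_extension (LinearMap.lsmul Λ W g) (a • χ) (by
      intro w hw
      obtain ⟨v, hv⟩ := (hV w).2 ⟨w.2, congrArg Subtype.val hw⟩
      obtain ⟨χN, hχN⟩ := Dual.exists_extension W.subtype χ fun x hx => by
        rw [(injective_iff_map_eq_zero _).1 W.subtype_injective x hx, map_zero]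
      let ψ : Dual p V := (AddMonoidHom.comp χN j.toAddMonoidHom : V →+ QpZp p)
      have h0 : χN (j (a • v)) = 0 := DFunLike.congr_fun (haV ψ) v
      rw [map_smul, hv] at h0
      rw [Dual.smul_apply, ← hχN]
      exact h0)
    exact ⟨χ', Dual.ext fun w => (hχ' w).symm⟩)
  refine ⟨b, hb, fun w hw => ?_⟩
  by_contra hcon
  obtain ⟨χ, hχ, hχb⟩ := Dual.exists_apply_ne_zero (p := p) (X := W) (fun w => by
      obtain ⟨k, hk⟩ := htors w
      exact ⟨k, Subtype.ext hk⟩) (LinearMap.range (LinearMap.lsmul Λ W g))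
    (x := b • (⟨w, hw⟩ : W)) (by
      rintro ⟨w', hw'⟩
      exact hcon ⟨w', w'.2, (congrArg Subtype.val hw').symm⟩)
  exact hχb (DFunLike.congr_fun (hbW χ (Dual.ext fun w' => hχ _ ⟨w', rfl⟩)) (⟨w, hw⟩ : W))

variable [TopologicalSpace Λ] [IsTopologicalRing Λ] {X : Type*} [AddCommGroup X] [Module Λ X]

variable (p) in
/-- The representation on `X ⊗ Λ^∨` induced by a representation on `X`. -/
noncomputable def tensorRep {J : Type*} [Group J] (ρ : Representation Λ J X) :
    Representation Λ J (X ⊗[Λ] ringDual p Λ) where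
  toFun σ := (ρ σ).rTensor (ringDual p Λ)
  map_one' := by
    rw [map_one]
    exact LinearMap.rTensor_id _ _
  map_mul' σ τ := by
    rw [map_mul]
    exact LinearMap.rTensor_mul _ _ _

theorem contract_dual_apply {J : Type*} [Group J] (ρ : Representation Λ J X) (σ : J)
    (f : X →ₗ[Λ] Λ) (n : X ⊗[Λ] ringDual p Λ) :
    contract p (ρ.dual σ f) n = contract p f (tensorRep p ρ σ⁻¹ n) :=
  contract_comp f (ρ σ⁻¹) n

/-- Moving σ from the form to the tensor, an invariant tensor cannot distinguish σf from f. -/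
theorem contract_eq_zero_of_mem_ker {J : Type*} [Group J] (ρ : Representation Λ J X)
    {d : Module.Dual Λ X} (hd : d ∈ Representation.Coinvariants.ker ρ.dual)
    {n : X ⊗[Λ] ringDual p Λ} (hn : n ∈ (tensorRep p ρ).invariants) : contract p d n = 0 := by
  induction hd using Submodule.span_induction with
  | mem d hd =>
    obtain ⟨⟨σ, f⟩, rfl⟩ := hd
    have h := contract_dual_apply ρ σ f n
    rw [hn σ⁻¹] at h
    have h2 := LinearMap.congr_fun (contract_add (p := p) (ρ.dual σ f - f) f) n
    rw [sub_add_cancel, LinearMap.add_apply, h] at h2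
    exact left_eq_add.1 (h2.trans (add_comm _ _))
  | zero => simp [contract]
  | add a b _ _ ha hb => rw [contract_add, LinearMap.add_apply, ha, hb, add_zero]
  | smul a d _ hd => rw [contract_smul, LinearMap.smul_apply, hd, smul_zero]

variable [IsLinearTopology Λ Λ] [CompactSpace Λ] [T2Space Λ]

/-- The dual of the invariants of `X ⊗ Λ^∨` is the module of coinvariants of `X^*`. -/
theorem mem_ker_of_forall_pairing_eq_zero (hp : Tendsto (fun n => (p : Λ) ^ n) atTop (𝓝 0))
    [IsNoetherianRing Λ] [Module.Finite Λ X] {J : Type*} [Group J] (ρ : Representation Λ J X)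
    {f : Module.Dual Λ X} (h : ∀ n ∈ (tensorRep p ρ).invariants, pairing p f n = 0) :
    f ∈ Representation.Coinvariants.ker ρ.dual := by
  have : Module.Finite Λ (Module.Dual Λ X) := inferInstanceAs (Module.Finite Λ (X →ₗ[Λ] Λ))
  -- By the double annihilator it suffices that a tensor n killed by all contractions against the
  -- kernel is invariant. Otherwise a character, which comes from a form, would detect σn - n.
  refine mem_of_forall_pairing_eq_zero hp (IsNoetherian.noetherian _) fun n hn => h n fun σ => ?_
  by_contra hne
  obtain ⟨χ, -, hχ⟩ := Dual.exists_apply_ne_zero (tensor_isTorsion hp)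
    (⊥ : Submodule Λ (X ⊗[Λ] ringDual p Λ)) (x := tensorRep p ρ σ n - n)
    (by rwa [Submodule.mem_bot, sub_eq_zero])
  obtain ⟨f, rfl⟩ := pairing_surjective hp χ
  refine hχ ?_
  have h1 := contract_dual_apply (p := p) ρ σ⁻¹ f n
  rw [inv_inv] at h1
  have h2 := hn _ (Representation.Coinvariants.sub_mem_ker (ρ := ρ.dual) σ⁻¹ f)
  have h3 := LinearMap.congr_fun (contract_add (p := p) (ρ.dual σ⁻¹ f - f) f) n
  rw [sub_add_cancel, LinearMap.add_apply, h2, h1, zero_add] at h3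
  rw [pairing_apply, map_sub, h3, sub_self]
  rfl

/-- The dual of W/gW is the g-torsion of the coinvariants of X^*, and for g ≠ 0 this equals C[g],
where C is their torsion submodule. The bound on C/gC then carries over to C[g]. -/
theorem exists_smul_invariants_of_torsCoinv [IsDomain Λ]
    (hp : Tendsto (fun n => (p : Λ) ^ n) atTop (𝓝 0))
    [IsNoetherianRing Λ] [Module.Finite Λ X] {J : Type*} [Group J] (ρ : Representation Λ J X)
    {g : Λ} (hg : g ≠ 0)
    (hC : PseudoNull Λ (torsCoinv ρ ⧸ (Ideal.span {g} • ⊤ : Submodule Λ (torsCoinv ρ))))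
    {P : PrimeSpectrum Λ} (hP : P.asIdeal.height < 2) :
    ∃ b ∉ P.asIdeal, ∀ w ∈ (tensorRep p ρ).invariants, ∃ w' ∈ (tensorRep p ρ).invariants,
      b • w = g • w' := by
  have : Module.Finite Λ (Module.Dual Λ X) := inferInstanceAs (Module.Finite Λ (X →ₗ[Λ] Λ))
  have : Module.Finite Λ ρ.dual.Coinvariants :=
    Module.Finite.of_surjective (Representation.Coinvariants.mk ρ.dual)
      (Representation.Coinvariants.mk_surjective _)
  obtain ⟨a, ha, haC⟩ := hC.exists_smul_eq_zero hP
  obtain ⟨b, hb, hbC⟩ := exists_smul_torsion_eq_zero (Y := torsCoinv ρ) P.asIdeal ha (g := g) (by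
    intro y
    have h := haC (Submodule.Quotient.mk y)
    rw [← Submodule.Quotient.mk_smul, Submodule.Quotient.mk_eq_zero,
      Submodule.ideal_span_singleton_smul] at h
    obtain ⟨z, -, hz⟩ := h
    exact ⟨z, hz.symm⟩)
  refine ⟨b, hb, fun w hw => ?_⟩
  let W := (tensorRep p ρ).invariants
  by_contra hcon
  obtain ⟨χ, hχ, hχb⟩ := Dual.exists_apply_ne_zero (p := p) (X := W) (fun w => by
      obtain ⟨k, hk⟩ := tensor_isTorsion hp (w : X ⊗[Λ] ringDual p Λ)
      exact ⟨k, Subtype.ext hk⟩) (LinearMap.range (LinearMap.lsmul Λ W g))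
    (x := b • (⟨w, hw⟩ : W)) (by
      rintro ⟨w', hw'⟩
      exact hcon ⟨w', w'.2, (congrArg Subtype.val hw').symm⟩)
  obtain ⟨χ', hχ'⟩ := Dual.exists_extension W.subtype χ fun x hx => by
    rw [(injective_iff_map_eq_zero _).1 W.subtype_injective x hx, map_zero]
  obtain ⟨f, rfl⟩ := pairing_surjective hp χ'
  -- Since χ vanishes on gW, the form g • f pairs trivially with all invariants.
  have hgf : g • f ∈ Representation.Coinvariants.ker ρ.dual := by
    refine mem_ker_of_forall_pairing_eq_zero hp ρ fun n hn => ?_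
    rw [map_smul, Dual.smul_apply]
    exact (hχ' (g • (⟨n, hn⟩ : W))).trans (hχ _ ⟨_, rfl⟩)
  have hg0 : g • Representation.Coinvariants.mk ρ.dual f = 0 := by
    rw [← map_smul]
    exact (Representation.Coinvariants.mk_eq_zero _).2 hgf
  have hbf := hbC ⟨Representation.Coinvariants.mk ρ.dual f,
    ⟨⟨g, mem_nonZeroDivisors_of_ne_zero hg⟩, hg0⟩⟩ (Subtype.ext hg0)
  have hbf' : b • f ∈ Representation.Coinvariants.ker ρ.dual := by
    rw [← Representation.Coinvariants.mk_eq_zero, map_smul]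
    exact congrArg Subtype.val hbf
  refine hχb ((hχ' _).symm.trans ?_)
  change pairing p f (b • w) = 0
  rw [← Dual.smul_apply, ← map_smul, pairing_apply, contract_eq_zero_of_mem_ker ρ hbf' hw]
  rfl

end Invariants

/-! ### The layers of a `ℤ_p`-extension -/

section Layers

variable {p : ℕ} [Fact p.Prime] {F : Type*} [Field F] (E : ZpExtension p F)

/-- An isomorphism of `G_∞` with `ℤ_p`. -/
noncomputable def ZpExtension.equivZp : E.Ginf ≃* Multiplicative ℤ_[p] :=
  E.isZp.some.toMulEquiv

/-- A topological generator of `G_∞`. -/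
noncomputable def ZpExtension.gamma : E.Ginf := E.equivZp.symm (Multiplicative.ofAdd 1)

/-- The image of the topological generator in `G_n`. -/
noncomputable def ZpExtension.gammaLayer (n : ℕ) : E.G n := QuotientGroup.mk E.gamma

theorem ZpExtension.gammaLayer_pow (n : ℕ) : E.gammaLayer n ^ p ^ n = 1 := by
  rw [gammaLayer, ← QuotientGroup.mk_pow, QuotientGroup.eq_one_iff]
  exact ⟨E.gamma, rfl⟩

theorem ZpExtension.equivZp_gamma_pow (k : ℕ) :
    E.equivZp (E.gamma ^ k) = Multiplicative.ofAdd (k : ℤ_[p]) := by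
  rw [map_pow, gamma, MulEquiv.apply_symm_apply, ← ofAdd_nsmul, nsmul_eq_mul, mul_one]

theorem ZpExtension.exists_gammaLayer_pow_eq (n : ℕ) (s : E.G n) :
    ∃ k : ℕ, s = E.gammaLayer n ^ k := by
  induction s using QuotientGroup.induction_on with
  | H g =>
  obtain ⟨z, hz⟩ := Ideal.mem_span_singleton.1 (PadicInt.appr_spec n (E.equivZp g).toAdd)
  refine ⟨(E.equivZp g).toAdd.appr n, ?_⟩
  rw [gammaLayer, ← QuotientGroup.mk_pow, eq_comm, QuotientGroup.eq]
  refine ⟨E.equivZp.symm (Multiplicative.ofAdd z), E.equivZp.injective ?_⟩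
  rw [powMonoidHom_apply, map_pow, MulEquiv.apply_symm_apply, map_mul, map_inv, equivZp_gamma_pow]
  refine Multiplicative.toAdd.injective ?_
  change (p ^ n) • z = -((E.equivZp g).toAdd.appr n : ℤ_[p]) + (E.equivZp g).toAdd
  rw [nsmul_eq_mul, Nat.cast_pow, ← hz]
  ring

instance (n : ℕ) : Finite (E.G n) := by
  refine Finite.of_surjective (fun k : Fin (p ^ n) => E.gammaLayer n ^ (k : ℕ)) fun s => ?_
  obtain ⟨k, rfl⟩ := E.exists_gammaLayer_pow_eq n s
  refine ⟨⟨k % p ^ n, Nat.mod_lt _ (pow_pos (Fact.out : p.Prime).pos _)⟩, ?_⟩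
  conv_rhs => rw [← Nat.mod_add_div k (p ^ n), pow_add, pow_mul, E.gammaLayer_pow, one_pow, mul_one]

/-- The projection `G_{n+1} → G_n`. -/
noncomputable def ZpExtension.projG (n : ℕ) : E.G (n + 1) →* E.G n :=
  QuotientGroup.map (E.layer (n + 1)) (E.layer n) (MonoidHom.id _) (E.layer_succ_le n)

theorem ZpExtension.projG_gammaLayer (n : ℕ) : E.projG n (E.gammaLayer (n + 1)) = E.gammaLayer n :=
  rfl

/-- The kernel contains `γ ^ p ^ n`, of exact order p in G_{n+1}: otherwise `p ^ n` would be a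
multiple of `p ^ (n + 1)` in ℤ_p. -/
theorem ZpExtension.dvd_card_ker_projG (n : ℕ) : p ∣ Nat.card (E.projG n).ker := by
  let h : (E.projG n).ker := ⟨E.gammaLayer (n + 1) ^ p ^ n, by
    rw [MonoidHom.mem_ker, map_pow, projG_gammaLayer, gammaLayer_pow]⟩
  have hord : orderOf h = p := by
    refine orderOf_eq_prime (Subtype.ext ?_) fun h1 => ?_
    · change (E.gammaLayer (n + 1) ^ p ^ n) ^ p = 1
      rw [← pow_mul, ← pow_succ, gammaLayer_pow]
    · have h2 : E.gammaLayer (n + 1) ^ p ^ n = 1 := congrArg Subtype.val h1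
      rw [gammaLayer, ← QuotientGroup.mk_pow, QuotientGroup.eq_one_iff] at h2
      obtain ⟨g, hg⟩ := h2
      have h3 := congrArg (fun x => (E.equivZp x).toAdd) hg
      simp only [equivZp_gamma_pow, powMonoidHom_apply] at h3
      rw [map_pow, toAdd_pow, toAdd_ofAdd, nsmul_eq_mul, pow_succ, Nat.cast_mul, mul_assoc] at h3
      have hp0 : ((p ^ n : ℕ) : ℤ_[p]) ≠ 0 := by
        exact_mod_cast (pow_pos (Fact.out : p.Prime).pos n).ne'
      have h4 := mul_left_cancel₀ hp0 (h3.trans (mul_one _).symm)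
      exact PadicInt.prime_p.not_isUnit (IsUnit.of_mul_eq_one _ h4)
  exact (dvd_of_eq hord.symm).trans (orderOf_dvd_natCard h)

end Layers

/-! ### Compactness of complete local rings -/

section Compact

open Filter Topology

theorem finite_quotient_maximalIdeal_pow (R : Type*) [CommRing R] [IsLocalRing R]
    [IsNoetherianRing R] [Finite (IsLocalRing.ResidueField R)] (n : ℕ) :
    Finite (R ⧸ IsLocalRing.maximalIdeal R ^ n) :=
  have : Finite (R ⧸ IsLocalRing.maximalIdeal R) :=
    inferInstanceAs (Finite (IsLocalRing.ResidueField R))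
  Ideal.finite_quotient_pow (IsNoetherian.noetherian _) n

/-- An ultrafilter selects one class modulo each power of I. These classes are compatible, and
completeness gives them a limit, to which the ultrafilter converges. -/
theorem compactSpace_adicTopology (R : Type*) [CommRing R] (I : Ideal R) [IsAdicComplete I R]
    (hfin : ∀ n, Finite (R ⧸ I ^ n)) : @CompactSpace R I.adicTopology := by
  let := I.adicTopology
  refine ⟨isCompact_iff_ultrafilter_le_nhds.2 fun f _ => ?_⟩
  have hex : ∀ n, ∃ r : R, {x : R | x - r ∈ I ^ n} ∈ f := by
    intro n
    have : Finite (R ⧸ I ^ n) := hfin n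
    obtain ⟨q, hq⟩ := (f.map (Ideal.Quotient.mk (I ^ n))).eq_pure_of_finite
    obtain ⟨r, rfl⟩ := Ideal.Quotient.mk_surjective q
    refine ⟨r, ?_⟩
    have h1 : {Ideal.Quotient.mk (I ^ n) r} ∈ f.map (Ideal.Quotient.mk (I ^ n)) := by
      rw [hq]
      exact Set.mem_singleton _
    refine Filter.mem_of_superset (Ultrafilter.mem_map.1 h1) fun x hx => ?_
    exact Ideal.Quotient.eq.1 hx
  choose r hr using hex
  obtain ⟨L, hL⟩ := IsPrecomplete.prec (I := I) (M := R) inferInstance (f := r) (by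
    intro m n hmn
    rw [SModEq.sub_mem, smul_eq_mul, Ideal.mul_top]
    obtain ⟨x, hx, hx'⟩ := f.nonempty_of_mem (Filter.inter_mem (hr m) (hr n))
    have := sub_mem (Ideal.pow_le_pow_right hmn hx') hx
    rwa [sub_sub_sub_cancel_left] at this)
  refine ⟨L, trivial, fun s hs => ?_⟩
  obtain ⟨n, -, hn⟩ := (I.hasBasis_nhds_adic L).mem_iff.1 hs
  refine Filter.mem_of_superset (hr n) fun x hx => hn ⟨x - L, ?_, by ring⟩
  have h1 := hL n
  rw [SModEq.sub_mem, smul_eq_mul, Ideal.mul_top] at h1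
  have := add_mem hx h1
  rwa [sub_add_sub_cancel] at this

end Compact

/-! ### The topology of the Iwasawa algebra -/

section IwasawaTopology

open Filter Topology IsLocalRing

variable {p : ℕ} [Fact p.Prime] {F : Type*} [Field F] (E : ZpExtension p F) (R : Type*) [CommRing R]

theorem Iwasawa.coeff_injective : Function.Injective (Iwasawa.coeff E R) := by
  intro x y h
  refine Subtype.ext (funext fun n => MonoidAlgebra.coeff_injective (Finsupp.ext fun s => ?_))
  exact congrFun (congrFun h n) s

theorem Iwasawa.coeff_zero : Iwasawa.coeff E R 0 = 0 := rfl

noncomputable instance (n : ℕ) : Fintype (E.G n) := Fintype.ofFinite _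

theorem coeff_mul_eq_sum {G : Type*} [Group G] [Fintype G] (x y : MonoidAlgebra R G) (s : G) :
    (x * y).coeff s = ∑ t, x.coeff t * y.coeff (t⁻¹ * s) := by
  rw [MonoidAlgebra.coeff_mul_apply_left]
  exact Finset.sum_subset (Finset.subset_univ _) fun t _ ht => by
    simp only [Finsupp.notMem_support_iff.1 ht, zero_mul]

theorem Iwasawa.coeff_mul (x y : Iwasawa E R) (n : ℕ) (s : E.G n) :
    Iwasawa.coeff E R (x * y) n s =
      ∑ t, Iwasawa.coeff E R x n t * Iwasawa.coeff E R y n (t⁻¹ * s) :=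
  coeff_mul_eq_sum R _ _ _

open Classical in
theorem coeff_proj (n : ℕ) (x : MonoidAlgebra R (E.G (n + 1))) (s : E.G n) :
    (E.proj R n x).coeff s = ∑ t with E.projG n t = s, x.coeff t := by
  change Finsupp.mapDomain (E.projG n) x.coeff s = _
  rw [Finsupp.mapDomain, Finsupp.sum_fintype _ _ (fun _ => Finsupp.single_zero _),
    Finsupp.finsetSum_apply, Finset.sum_filter]
  exact Finset.sum_congr rfl fun t _ => Finsupp.single_apply

open Classical in
theorem Iwasawa.sum_coeff_succ (x : Iwasawa E R) (n : ℕ) (s : E.G n) :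
    ∑ t with E.projG n t = s, Iwasawa.coeff E R x (n + 1) t = Iwasawa.coeff E R x n s := by
  have h := coeff_proj E R n (x.1 (n + 1)) s
  rw [x.2 n] at h
  exact h.symm

/-- The kernel of `Λ_R → (R/I)[G_n]`. -/
noncomputable def Iwasawa.coeffIdeal (I : Ideal R) (n : ℕ) : Ideal (Iwasawa E R) where
  carrier := {x | ∀ s, Iwasawa.coeff E R x n s ∈ I}
  zero_mem' _ := I.zero_mem
  add_mem' hx hy s := I.add_mem (hx s) (hy s)
  smul_mem' a x hx s := by
    rw [smul_eq_mul, Iwasawa.coeff_mul]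
    exact I.sum_mem fun t _ => I.mul_mem_left _ (hx _)

theorem Iwasawa.coeffIdeal_antitone (I : Ideal R) : Antitone (Iwasawa.coeffIdeal E R I) := by
  classical
  refine antitone_nat_of_succ_le fun n x hx s => ?_
  rw [← Iwasawa.sum_coeff_succ]
  exact I.sum_mem fun t _ => hx t

variable [IsLocalRing R]

theorem Iwasawa.isInducing_coeff :
    letI := (maximalIdeal R).adicTopology
    IsInducing (Iwasawa.coeff E R) :=
  letI := (maximalIdeal R).adicTopology
  ⟨rfl⟩

theorem Iwasawa.continuous_coeff (n : ℕ) (s : E.G n) :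
    letI := (maximalIdeal R).adicTopology
    Continuous fun x => Iwasawa.coeff E R x n s :=
  letI := (maximalIdeal R).adicTopology
  (continuous_apply s).comp ((continuous_apply n).comp (Iwasawa.isInducing_coeff E R).continuous)

instance : IsTopologicalRing (Iwasawa E R) := by
  let := (maximalIdeal R).adicTopology
  have : NonarchimedeanRing R := (maximalIdeal R).nonarchimedean
  have hc := Iwasawa.continuous_coeff E R
  refine { continuous_add := ?_, continuous_mul := ?_, continuous_neg := ?_ } <;>
    refine continuous_induced_rng.2 (continuous_pi fun n => continuous_pi fun s => ?_)
  · exact ((hc n s).comp continuous_fst).add ((hc n s).comp continuous_snd)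
  · have h : (fun z : Iwasawa E R × Iwasawa E R =>
        (Iwasawa.coeff E R ∘ fun z : Iwasawa E R × Iwasawa E R => z.1 * z.2) z n s) =
        fun z => ∑ t, Iwasawa.coeff E R z.1 n t * Iwasawa.coeff E R z.2 n (t⁻¹ * s) :=
      funext fun z => Iwasawa.coeff_mul E R z.1 z.2 n s
    rw [h]
    exact continuous_finsetSum _ fun t _ =>
      ((hc n t).comp continuous_fst).mul ((hc n _).comp continuous_snd)
  · exact (hc n s).neg

theorem Iwasawa.isOpen_coeffIdeal (n k : ℕ) :
    IsOpen (Iwasawa.coeffIdeal E R (maximalIdeal R ^ k) n : Set (Iwasawa E R)) := by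
  let := (maximalIdeal R).adicTopology
  have hk : IsOpen ((maximalIdeal R ^ k : Ideal R) : Set R) := by
    have := ((maximalIdeal R).openAddSubgroup k).isOpen
    exact this
  have h : (Iwasawa.coeffIdeal E R (maximalIdeal R ^ k) n : Set (Iwasawa E R)) =
      ⋂ s, (fun x => Iwasawa.coeff E R x n s) ⁻¹' (maximalIdeal R ^ k : Ideal R) := by
    ext x
    simp only [Set.mem_iInter]
    exact Iff.rfl
  rw [h]
  exact isOpen_iInter_of_finite fun s => hk.preimage (Iwasawa.continuous_coeff E R n s)

/-- One index serves both for the layer and for the power of 𝔪, because coefficients in lower layers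
are sums of those in higher ones. As the basis consists of ideals, the topology is linear. -/
theorem Iwasawa.hasBasis_nhds_zero : (𝓝 (0 : Iwasawa E R)).HasBasis (fun _ : ℕ => True)
    fun n => (Iwasawa.coeffIdeal E R (maximalIdeal R ^ n) n : Set (Iwasawa E R)) := by
  let := (maximalIdeal R).adicTopology
  refine ⟨fun U => ⟨fun hU => ?_, fun ⟨n, _, hn⟩ =>
    Filter.mem_of_superset ((Iwasawa.isOpen_coeffIdeal E R n n).mem_nhds (Ideal.zero_mem _)) hn⟩⟩
  let B : Filter (Iwasawa E R) :=
    ⨅ n : ℕ, 𝓟 (Iwasawa.coeffIdeal E R (maximalIdeal R ^ n) n : Set (Iwasawa E R))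
  have hanti : Antitone fun n : ℕ => Iwasawa.coeffIdeal E R (maximalIdeal R ^ n) n := by
    intro m n hmn x hx
    exact Iwasawa.coeffIdeal_antitone E R _ hmn fun s => Ideal.pow_le_pow_right hmn (hx s)
  have hB : B.HasBasis (fun _ : ℕ => True)
      fun n => (Iwasawa.coeffIdeal E R (maximalIdeal R ^ n) n : Set (Iwasawa E R)) :=
    Filter.hasBasis_iInf_principal (directed_of_isDirected_le fun m n hmn => hanti hmn)
  have hle : B ≤ 𝓝 (0 : Iwasawa E R) := by
    rw [(Iwasawa.isInducing_coeff E R).nhds_eq_comap, ← Filter.tendsto_iff_comap,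
      tendsto_pi_nhds]
    intro n
    rw [tendsto_pi_nhds]
    intro s
    rw [Iwasawa.coeff_zero]
    refine (((maximalIdeal R).hasBasis_nhds_zero_adic).tendsto_right_iff).2 fun k _ => ?_
    refine Filter.mem_of_superset (hB.mem_of_mem (i := max n k) trivial) fun x hx => ?_
    exact Ideal.pow_le_pow_right (le_max_right n k)
      (Iwasawa.coeffIdeal_antitone E R _ (le_max_left n k) hx s)
  obtain ⟨n, -, hn⟩ := hB.mem_iff.1 (hle hU)
  exact ⟨n, trivial, hn⟩

instance : IsLinearTopology (Iwasawa E R) (Iwasawa E R) :=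
  IsLinearTopology.mk_of_hasBasis _ (Iwasawa.hasBasis_nhds_zero E R)

theorem Iwasawa.tendsto_natCast_pow [CharP (ResidueField R) p] :
    Tendsto (fun n => (p : Iwasawa E R) ^ n) atTop (𝓝 0) := by
  refine ((Iwasawa.hasBasis_nhds_zero E R).tendsto_right_iff).2 fun n _ => ?_
  filter_upwards [eventually_ge_atTop n] with k hk s
  have hp : (p : R) ∈ maximalIdeal R := by
    rw [← residue_eq_zero_iff, map_natCast, CharP.cast_eq_zero]
  have h : (p : Iwasawa E R) ^ k = ((p : R) ^ k) • (1 : Iwasawa E R) := by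
    rw [Algebra.smul_def, mul_one, map_pow, map_natCast]
  rw [h]
  change ((p : R) ^ k) * Iwasawa.coeff E R 1 n s ∈ _
  exact Ideal.mul_mem_right _ _ (Ideal.pow_le_pow_right hk (Ideal.pow_mem_pow hp k))

variable [IsAdicComplete (maximalIdeal R) R]

theorem t2Space_adicTopology : @T2Space R (maximalIdeal R).adicTopology := by
  let := (maximalIdeal R).adicTopology
  have : NonarchimedeanRing R := (maximalIdeal R).nonarchimedean
  have h : IsAdic (maximalIdeal R) := rfl
  exact h.isHausdorff_iff.1 inferInstance

instance : T2Space (Iwasawa E R) := by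
  let := (maximalIdeal R).adicTopology
  have := t2Space_adicTopology R
  exact T2Space.of_injective_continuous (Iwasawa.coeff_injective E R)
    (Iwasawa.isInducing_coeff E R).continuous

/-- Compatibility of the layers is a closed condition in a product of copies of the compact ring R.
-/
instance [IsNoetherianRing R] [Finite (ResidueField R)] : CompactSpace (Iwasawa E R) := by
  classical
  let := (maximalIdeal R).adicTopology
  have : NonarchimedeanRing R := (maximalIdeal R).nonarchimedean
  have := t2Space_adicTopology R
  have : CompactSpace R := compactSpace_adicTopology R (maximalIdeal R)
    (finite_quotient_maximalIdeal_pow R)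
  have hrange : Set.range (Iwasawa.coeff E R) =
      ⋂ n, ⋂ s, {f | ∑ t with E.projG n t = s, f (n + 1) t = f n s} := by
    ext f
    simp only [Set.mem_iInter, Set.mem_ofPred_eq]
    constructor
    · rintro ⟨x, rfl⟩ n s
      exact Iwasawa.sum_coeff_succ E R x n s
    · intro hf
      refine ⟨⟨fun n => MonoidAlgebra.ofCoeff (Finsupp.equivFunOnFinite.symm (f n)), fun n =>
        MonoidAlgebra.coeff_injective (Finsupp.ext fun s => ?_)⟩, rfl⟩
      rw [coeff_proj]
      exact hf n s
  have hcl : IsClosedEmbedding (Iwasawa.coeff E R) :=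
    { toIsInducing := Iwasawa.isInducing_coeff E R
      injective := Iwasawa.coeff_injective E R
      isClosed_range := by
        rw [hrange]
        refine isClosed_iInter fun n => isClosed_iInter fun s => isClosed_eq ?_ ?_
        · exact continuous_finsetSum _ fun t _ =>
            (continuous_apply t).comp (continuous_apply (n + 1))
        · exact (continuous_apply s).comp (continuous_apply n) }
  exact hcl.compactSpace

end IwasawaTopology

/-! ### Rings complete with respect to a principal ideal -/

section Complete

/-- Write nonzero elements as powers of t times elements outside (t). If a product vanishes,
cancelling t leaves two elements outside the prime (t) with product 0. -/
theorem isDomain_of_isPrime_of_forall_pow_dvd {A : Type*} [CommRing A] {t : A}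
    (hsep : ∀ x : A, (∀ n, t ^ n ∣ x) → x = 0) (hreg : ∀ x, t * x = 0 → x = 0)
    (hprime : (Ideal.span {t}).IsPrime) : IsDomain A := by
  have : Nontrivial A := by
    by_contra h
    rw [not_nontrivial_iff_subsingleton] at h
    exact hprime.ne_top (Ideal.eq_top_of_isUnit_mem _ (Ideal.zero_mem _) (isUnit_of_subsingleton 0))
  have hpow : ∀ n x, t ^ n * x = 0 → x = 0 := by
    intro n
    induction n with
    | zero => intro x hx; simpa using hx
    | succ n ih => intro x hx; exact hreg x (ih _ (by rw [← mul_assoc, ← pow_succ, hx]))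
  have hdec : ∀ x : A, x ≠ 0 → ∃ n y, x = t ^ n * y ∧ y ∉ Ideal.span {t} := by
    intro x hx
    have hfin : FiniteMultiplicity t x := by
      by_contra hcon
      exact hx (hsep x (FiniteMultiplicity.not_iff_forall.1 hcon))
    obtain ⟨y, hy, hty⟩ := hfin.exists_eq_pow_mul_and_not_dvd
    exact ⟨_, y, hy, fun h => hty (Ideal.mem_span_singleton.1 h)⟩
  have : NoZeroDivisors A := ⟨fun {x y} hxy => by
    by_contra! hcon
    obtain ⟨m, x', rfl, hx'⟩ := hdec x hcon.1
    obtain ⟨n, y', rfl, hy'⟩ := hdec y hcon.2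
    have h0 : x' * y' = 0 := hpow (m + n) _ (by rw [← hxy]; ring)
    rcases hprime.mem_or_mem (h0 ▸ Ideal.zero_mem _ : x' * y' ∈ Ideal.span {t}) with h | h
    · exact hx' h
    · exact hy' h⟩
  exact NoZeroDivisors.to_isDomain A

/-- Completeness along t: the cosets of `t ^ n * A` through the partial sums are nested compact
sets, so they have a common point. -/
theorem exists_forall_pow_dvd_sub_sum {A : Type*} [CommRing A] [TopologicalSpace A]
    [IsTopologicalRing A] [CompactSpace A] [T2Space A] (t : A) (c : ℕ → A) :
    ∃ a, ∀ n, t ^ n ∣ a - ∑ k ∈ Finset.range n, t ^ k * c k := by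
  let K : ℕ → Set A := fun n => Set.range fun y => ∑ k ∈ Finset.range n, t ^ k * c k + t ^ n * y
  have hcomp : ∀ n, IsCompact (K n) := fun n => isCompact_range (by fun_prop)
  obtain ⟨a, ha⟩ := IsCompact.nonempty_iInter_of_sequence_nonempty_isCompact_isClosed K
    (by
      rintro n _ ⟨y, rfl⟩
      refine ⟨c n + t * y, ?_⟩
      simp only [Finset.sum_range_succ]
      ring)
    (fun n => Set.range_nonempty _) (hcomp 0) fun n => (hcomp n).isClosed
  refine ⟨a, fun n => ?_⟩
  obtain ⟨y, hy⟩ := Set.mem_iInter.1 ha n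
  exact ⟨y, by rw [← hy]; ring⟩

/-- Cohen's theorem reduces to a prime P. Lift generators of its image to w_i ∈ P. If t ∈ P, the w_i
and t generate; if not, successive approximation shows that the w_i alone do. -/
theorem isNoetherianRing_of_surjective_of_forall_pow_dvd {A B : Type*} [CommRing A]
    [TopologicalSpace A] [IsTopologicalRing A] [CompactSpace A] [T2Space A] [CommRing B]
    [IsNoetherianRing B] (f : A →+* B) (hf : Function.Surjective f) {t : A}
    (hker : ∀ x, f x = 0 → t ∣ x) (hsep : ∀ x : A, (∀ n, t ^ n ∣ x) → x = 0) :
    IsNoetherianRing A := by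
  refine IsNoetherianRing.of_prime fun P hP => ?_
  obtain ⟨n, v, hv⟩ := Submodule.fg_iff_exists_fin_generating_family.1
    (IsNoetherian.noetherian (P.map f))
  have hvP : ∀ i, ∃ w ∈ P, f w = v i := fun i =>
    (Ideal.mem_map_iff_of_surjective f hf).1 (hv ▸ Submodule.subset_span ⟨i, rfl⟩)
  choose w hwP hw using hvP
  have key : ∀ x ∈ P, ∃ (c : Fin n → A) (y : A), x = ∑ i, c i * w i + t * y := by
    intro x hx
    have h1 : f x ∈ Submodule.span B (Set.range v) := hv ▸ Ideal.mem_map_of_mem f hx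
    obtain ⟨r, hr⟩ := (Submodule.mem_span_range_iff_exists_fun B).1 h1
    choose c hc using fun i => hf (r i)
    obtain ⟨y, hy⟩ := hker (x - ∑ i, c i * w i) (by
      rw [map_sub, map_sum, ← hr, sub_eq_zero]
      exact Finset.sum_congr rfl fun i _ => by rw [map_mul, hc, hw, smul_eq_mul])
    exact ⟨c, y, by rw [← hy]; ring⟩
  have hspan : ∀ c : Fin n → A, ∑ i, c i * w i ∈ Ideal.span (Set.range w) := fun c =>
    Ideal.sum_mem _ fun i _ => Ideal.mul_mem_left _ _ (Ideal.subset_span ⟨i, rfl⟩)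
  by_cases ht : t ∈ P
  · refine Submodule.fg_def.2 ⟨insert t (Set.range w), (Set.finite_range w).insert t,
      le_antisymm (Ideal.span_le.2 ?_) fun x hx => ?_⟩
    · rintro _ (rfl | ⟨i, rfl⟩)
      · exact ht
      · exact hwP i
    · obtain ⟨c, y, rfl⟩ := key x hx
      exact Ideal.add_mem _ (Ideal.span_mono (Set.subset_insert _ _) (hspan c))
        (Ideal.mul_mem_right _ _ (Ideal.subset_span (Set.mem_insert _ _)))
  · refine Submodule.fg_def.2 ⟨Set.range w, Set.finite_range w,
      le_antisymm (Ideal.span_le.2 ?_) fun x hx => ?_⟩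
    · rintro _ ⟨i, rfl⟩
      exact hwP i
    -- As t ∉ P, primality keeps the remainder y in P, so the division can be iterated.
    have key' : ∀ x : P, ∃ (c : Fin n → A) (y : P), (x : A) = ∑ i, c i * w i + t * y := by
      rintro ⟨x, hx⟩
      obtain ⟨c, y, hy⟩ := key x hx
      have hty : t * y ∈ P := by
        have h1 : t * y = x - ∑ i, c i * w i := by rw [hy]; ring
        rw [h1]
        exact P.sub_mem hx (Ideal.sum_mem _ fun i _ => P.mul_mem_left _ (hwP i))
      exact ⟨c, ⟨y, (hP.mem_or_mem hty).resolve_left ht⟩, hy⟩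
    choose c y hcy using key'
    let z : ℕ → P := fun k => y^[k] ⟨x, hx⟩
    have hz : ∀ k, x = ∑ i, (∑ j ∈ Finset.range k, t ^ j * c (z j) i) * w i + t ^ k * z k := by
      intro k
      induction k with
      | zero => simp [z]
      | succ k ih =>
        have h1 : z (k + 1) = y (z k) := Function.iterate_succ_apply' _ _ _
        conv_lhs => rw [ih, hcy (z k)]
        simp only [Finset.sum_range_succ, add_mul, Finset.sum_add_distrib, h1, mul_add,
          Finset.mul_sum, pow_succ]
        simp only [mul_assoc]
        ring
    choose a ha using fun i => exists_forall_pow_dvd_sub_sum t fun j => c (z j) i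
    have hx' : x = ∑ i, a i * w i := by
      rw [← sub_eq_zero]
      refine hsep _ fun k => ?_
      have h1 : x - ∑ i, a i * w i = t ^ k * z k -
          ∑ i, (a i - ∑ j ∈ Finset.range k, t ^ j * c (z j) i) * w i := by
        conv_lhs => rw [hz k]
        simp only [sub_mul, Finset.sum_sub_distrib]
        ring
      rw [h1]
      exact dvd_sub (dvd_mul_right _ _) (Finset.dvd_sum fun i _ => (ha i k).mul_right _)
    rw [hx']
    exact hspan a

end Complete

/-! ### The Iwasawa algebra is a noetherian domain -/

section IwasawaDomain

open IsLocalRing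

variable {p : ℕ} [Fact p.Prime] {F : Type*} [Field F] (E : ZpExtension p F) (R : Type*) [CommRing R]

/-- The topological generator as an element of the Iwasawa algebra. -/
noncomputable def Iwasawa.gen : Iwasawa E R :=
  ⟨fun n => MonoidAlgebra.single (E.gammaLayer n) 1, fun _ =>
    MonoidAlgebra.mapDomain_single⟩

/-- The projection `Λ_R → R[G_n]`. -/
noncomputable def Iwasawa.toLayer (n : ℕ) : Iwasawa E R →ₐ[R] MonoidAlgebra R (E.G n) :=
  (Pi.evalAlgHom R (fun n => MonoidAlgebra R (E.G n)) n).comp (iwasawaSubalgebra E R).val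

theorem Iwasawa.toLayer_gen (n : ℕ) :
    Iwasawa.toLayer E R n (Iwasawa.gen E R) = MonoidAlgebra.single (E.gammaLayer n) 1 := rfl

theorem Iwasawa.proj_toLayer (n : ℕ) (x : Iwasawa E R) :
    E.proj R n (Iwasawa.toLayer E R (n + 1) x) = Iwasawa.toLayer E R n x := x.2 n

theorem Iwasawa.coeff_toLayer (n : ℕ) (x : Iwasawa E R) (s : E.G n) :
    (Iwasawa.toLayer E R n x).coeff s = Iwasawa.coeff E R x n s := rfl

theorem Iwasawa.toLayer_surjective (n : ℕ) : Function.Surjective (Iwasawa.toLayer E R n) := by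
  rw [← AlgHom.range_eq_top, eq_top_iff]
  intro x _
  induction x using MonoidAlgebra.induction_linear with
  | zero => exact zero_mem _
  | add x y hx hy => exact add_mem (hx trivial) (hy trivial)
  | single s r =>
    obtain ⟨k, rfl⟩ := E.exists_gammaLayer_pow_eq n s
    refine ⟨r • Iwasawa.gen E R ^ k, ?_⟩
    change Iwasawa.toLayer E R n (r • Iwasawa.gen E R ^ k) = _
    rw [map_smul, map_pow, Iwasawa.toLayer_gen, MonoidAlgebra.single_pow, one_pow,
      MonoidAlgebra.smul_single, smul_eq_mul, mul_one]

/-- The augmentation of `R[G_n]`. -/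
noncomputable def layerAug (n : ℕ) : MonoidAlgebra R (E.G n) →ₐ[R] R :=
  MonoidAlgebra.lift R R (E.G n) 1

theorem layerAug_single (n : ℕ) (s : E.G n) (r : R) :
    layerAug E R n (MonoidAlgebra.single s r) = r := by
  simp [layerAug]

theorem layerAug_proj (n : ℕ) (x : MonoidAlgebra R (E.G (n + 1))) :
    layerAug E R n (E.proj R n x) = layerAug E R (n + 1) x := by
  induction x using MonoidAlgebra.induction_linear with
  | zero => simp only [map_zero]
  | add x y hx hy => simp only [map_add, hx, hy]
  | single s r =>
    rw [layerAug_single, show E.proj R n (MonoidAlgebra.single s r) =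
      MonoidAlgebra.single (E.projG n s) r from MonoidAlgebra.mapDomain_single, layerAug_single]

theorem single_sub_single_one_mem (n : ℕ) (x : MonoidAlgebra R (E.G n)) :
    x - algebraMap R _ (layerAug E R n x) ∈
      Ideal.span {(MonoidAlgebra.single (E.gammaLayer n) 1 - 1 : MonoidAlgebra R (E.G n))} := by
  induction x using MonoidAlgebra.induction_linear with
  | zero => simp only [map_zero, sub_zero]; exact Ideal.zero_mem _
  | add x y hx hy =>
    rw [map_add, map_add, add_sub_add_comm]
    exact Ideal.add_mem _ hx hy
  | single s r =>
    obtain ⟨k, rfl⟩ := E.exists_gammaLayer_pow_eq n s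
    have h : (MonoidAlgebra.single (E.gammaLayer n ^ k) r : MonoidAlgebra R (E.G n)) =
        algebraMap R _ r * (MonoidAlgebra.single (E.gammaLayer n) 1) ^ k := by
      rw [MonoidAlgebra.single_pow, one_pow, ← Algebra.smul_def, MonoidAlgebra.smul_single,
        smul_eq_mul, mul_one]
    rw [layerAug_single, h, ← mul_sub_one]
    exact Ideal.mul_mem_left _ _ (Ideal.mem_span_singleton.2 (sub_one_dvd_pow_sub_one _ _))

/-- The augmentation of `Λ_R`. -/
noncomputable def Iwasawa.aug : Iwasawa E R →ₐ[R] R :=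
  (layerAug E R 0).comp (Iwasawa.toLayer E R 0)

theorem Iwasawa.layerAug_toLayer (n : ℕ) (x : Iwasawa E R) :
    layerAug E R n (Iwasawa.toLayer E R n x) = Iwasawa.aug E R x := by
  induction n with
  | zero => rfl
  | succ n ih => rw [← ih, ← Iwasawa.proj_toLayer E R n, layerAug_proj]

theorem Iwasawa.aug_surjective : Function.Surjective (Iwasawa.aug E R) := fun r =>
  ⟨algebraMap R _ r, (Iwasawa.aug E R).commutes r⟩

theorem Iwasawa.ext_toLayer {x y : Iwasawa E R}
    (h : ∀ n, Iwasawa.toLayer E R n x = Iwasawa.toLayer E R n y) : x = y :=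
  Subtype.ext (funext h)

theorem Iwasawa.aug_gen : Iwasawa.aug E R (Iwasawa.gen E R) = 1 := by
  rw [← Iwasawa.layerAug_toLayer E R 0, Iwasawa.toLayer_gen, layerAug_single]

/-- With t = γ - 1 in the n-th layer, `(t + 1) ^ p ^ n = 1`, and p divides every intermediate
binomial coefficient. -/
theorem Iwasawa.natCast_dvd_toLayer_gen_sub_one_pow (n : ℕ) :
    (p : MonoidAlgebra R (E.G n)) ∣ Iwasawa.toLayer E R n (Iwasawa.gen E R - 1) ^ p ^ n := by
  let t := Iwasawa.toLayer E R n (Iwasawa.gen E R - 1)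
  have h1 : (t + 1) ^ p ^ n = 1 := by
    simp only [t]
    rw [map_sub, map_one, sub_add_cancel, Iwasawa.toLayer_gen, MonoidAlgebra.single_pow,
      E.gammaLayer_pow, one_pow, MonoidAlgebra.one_def]
  rw [add_pow_prime_pow_eq (Fact.out : p.Prime), one_pow] at h1
  exact ⟨-(t * 1 * ∑ k ∈ Finset.Ioo 0 (p ^ n),
    t ^ (k - 1) * 1 ^ (p ^ n - k - 1) * ((p ^ n).choose k / p : ℕ)), by linear_combination h1⟩

theorem eq_zero_of_forall_natCast_pow_dvd (R : Type*) [CommRing R] [IsRegularLocalRing R] {p : ℕ}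
    [CharP (ResidueField R) p] {r : R} (h : ∀ k, (p : R) ^ k ∣ r) : r = 0 := by
  have hp : (p : R) ∈ maximalIdeal R := by
    rw [← residue_eq_zero_iff, map_natCast, CharP.cast_eq_zero]
  refine IsHausdorff.haus (I := maximalIdeal R) (M := R) inferInstance r fun k => ?_
  rw [SModEq.zero, smul_eq_mul, Ideal.mul_top]
  obtain ⟨z, rfl⟩ := h k
  exact Ideal.mul_mem_right _ _ (Ideal.pow_mem_pow hp k)

variable [IsRegularLocalRing R]

/-- Each layer has a solution, since γ - 1 generates its augmentation ideal. The solution sets are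
closed and nested in the compact Λ, so they share a point. -/
theorem Iwasawa.gen_sub_one_dvd_of_aug_eq_zero [IsAdicComplete (maximalIdeal R) R]
    [Finite (ResidueField R)] {x : Iwasawa E R} (h : Iwasawa.aug E R x = 0) :
    Iwasawa.gen E R - 1 ∣ x := by
  let := (maximalIdeal R).adicTopology
  have := t2Space_adicTopology R
  let K : ℕ → Set (Iwasawa E R) := fun n =>
    {y | Iwasawa.toLayer E R n ((Iwasawa.gen E R - 1) * y) = Iwasawa.toLayer E R n x}
  have hK : ∀ n, IsClosed (K n) := by
    intro n
    have hKn : K n = ⋂ s, {y | Iwasawa.coeff E R ((Iwasawa.gen E R - 1) * y) n s =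
        Iwasawa.coeff E R x n s} := by
      ext y
      simp only [Set.mem_iInter]
      exact ⟨fun hy s => congrArg (fun z : MonoidAlgebra R (E.G n) => z.coeff s) hy,
        fun hy => MonoidAlgebra.coeff_injective (Finsupp.ext hy)⟩
    rw [hKn]
    exact isClosed_iInter fun s => isClosed_eq
      ((Iwasawa.continuous_coeff E R n s).comp (continuous_const.mul continuous_id))
      continuous_const
  obtain ⟨y, hy⟩ := IsCompact.nonempty_iInter_of_sequence_nonempty_isCompact_isClosed K
    (by
      intro n y hy
      have := congrArg (E.proj R n) hy
      rwa [Iwasawa.proj_toLayer, Iwasawa.proj_toLayer] at this)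
    (by
      intro n
      have h1 := single_sub_single_one_mem E R n (Iwasawa.toLayer E R n x)
      rw [Iwasawa.layerAug_toLayer, h, map_zero, sub_zero] at h1
      obtain ⟨z, hz⟩ := Ideal.mem_span_singleton.1 h1
      obtain ⟨y, rfl⟩ := Iwasawa.toLayer_surjective E R n z
      refine ⟨y, ?_⟩
      change Iwasawa.toLayer E R n _ = _
      rw [hz, map_mul, map_sub, map_one, Iwasawa.toLayer_gen])
    (hK 0).isCompact hK
  exact ⟨y, Iwasawa.ext_toLayer E R fun n => (Set.mem_iInter.1 hy n).symm⟩

variable [CharP (ResidueField R) p]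

/-- In the n-th layer `(γ - 1) ^ (p ^ n * k)` is divisible by `p ^ k`, so the coefficients of x are
divisible by all powers of p and vanish. -/
theorem Iwasawa.eq_zero_of_forall_gen_sub_one_pow_dvd {x : Iwasawa E R}
    (h : ∀ n, (Iwasawa.gen E R - 1) ^ n ∣ x) : x = 0 := by
  refine Iwasawa.coeff_injective E R (funext fun n => funext fun s => ?_)
  refine eq_zero_of_forall_natCast_pow_dvd (p := p) R fun k => ?_
  have h1 : (p : MonoidAlgebra R (E.G n)) ^ k ∣ Iwasawa.toLayer E R n x := by
    have h2 := map_dvd (Iwasawa.toLayer E R n) (h (p ^ n * k))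
    rw [map_pow, pow_mul] at h2
    exact (pow_dvd_pow_of_dvd (Iwasawa.natCast_dvd_toLayer_gen_sub_one_pow E R n) k).trans h2
  obtain ⟨y, hy⟩ := h1
  have h2 : (p : MonoidAlgebra R (E.G n)) ^ k * y = ((p : R) ^ k) • y := by
    rw [Algebra.smul_def, map_pow, map_natCast]
  rw [← Iwasawa.coeff_toLayer, hy, h2]
  exact dvd_mul_right _ _

/-- Invariance under γ makes the coefficients constant in each layer. The constant in layer n is a
multiple of p times the one in layer n + 1, hence infinitely p-divisible. -/
theorem Iwasawa.eq_zero_of_gen_sub_one_mul_eq_zero {x : Iwasawa E R}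
    (h : (Iwasawa.gen E R - 1) * x = 0) : x = 0 := by
  classical
  have hx : Iwasawa.gen E R * x = x := by linear_combination h
  have hmul : ∀ n s, Iwasawa.coeff E R x n (E.gammaLayer n * s) = Iwasawa.coeff E R x n s := by
    intro n s
    have h1 : Iwasawa.toLayer E R n x =
        MonoidAlgebra.single (E.gammaLayer n) 1 * Iwasawa.toLayer E R n x := by
      conv_lhs => rw [← hx, map_mul, Iwasawa.toLayer_gen]
    have h2 := congrArg (fun z => z.coeff (E.gammaLayer n * s)) h1
    simp only [MonoidAlgebra.coeff_single_mul_apply, inv_mul_cancel_left, one_mul] at h2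
    exact h2
  have hconst : ∀ n s, Iwasawa.coeff E R x n s = Iwasawa.coeff E R x n 1 := by
    intro n s
    obtain ⟨k, rfl⟩ := E.exists_gammaLayer_pow_eq n s
    induction k with
    | zero => rw [pow_zero]
    | succ k ih => rw [pow_succ', hmul, ih]
  have hdvd : ∀ k n, (p : R) ^ k ∣ Iwasawa.coeff E R x n 1 := by
    intro k
    induction k with
    | zero => intro n; rw [pow_zero]; exact one_dvd _
    | succ k ih =>
      intro n
      have h1 := Iwasawa.sum_coeff_succ E R x n 1
      rw [Finset.sum_congr rfl fun t _ => hconst (n + 1) t, Finset.sum_const, nsmul_eq_mul] at h1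
      rw [← h1, pow_succ']
      refine mul_dvd_mul ?_ (ih (n + 1))
      have h2 : (Finset.univ.filter fun t => E.projG n t = 1).card =
          Nat.card (E.projG n).ker := by
        rw [Nat.card_eq_fintype_card, Fintype.card_subtype]
        simp only [MonoidHom.mem_ker]
      rw [h2]
      exact_mod_cast Nat.cast_dvd_cast (α := R) (E.dvd_card_ker_projG n)
  refine Iwasawa.coeff_injective E R (funext fun n => funext fun s => ?_)
  rw [hconst]
  exact eq_zero_of_forall_natCast_pow_dvd (p := p) R fun k => hdvd k n

variable [IsAdicComplete (maximalIdeal R) R] [Finite (ResidueField R)]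

theorem Iwasawa.isNoetherianRing : IsNoetherianRing (Iwasawa E R) :=
  isNoetherianRing_of_surjective_of_forall_pow_dvd (Iwasawa.aug E R).toRingHom
    (Iwasawa.aug_surjective E R) (fun _ h => Iwasawa.gen_sub_one_dvd_of_aug_eq_zero E R h)
    fun _ h => Iwasawa.eq_zero_of_forall_gen_sub_one_pow_dvd E R h

/-- The ideal (γ - 1) is the kernel of the augmentation onto the domain R, hence prime. -/
theorem Iwasawa.isDomain : IsDomain (Iwasawa E R) := by
  have := isDomain_of_isRegularLocalRing R
  refine isDomain_of_isPrime_of_forall_pow_dvd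
    (fun _ h => Iwasawa.eq_zero_of_forall_gen_sub_one_pow_dvd E R h)
    (fun _ h => Iwasawa.eq_zero_of_gen_sub_one_mul_eq_zero E R h) ?_
  have hker : Ideal.span {Iwasawa.gen E R - 1} = RingHom.ker (Iwasawa.aug E R) := by
    refine le_antisymm ((Ideal.span_singleton_le_iff_mem _).2 ?_) fun x hx =>
      Ideal.mem_span_singleton.2 (Iwasawa.gen_sub_one_dvd_of_aug_eq_zero E R hx)
    rw [RingHom.mem_ker, map_sub, map_one, Iwasawa.aug_gen, sub_self]
  rw [hker]
  exact RingHom.ker_isPrime _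

end IwasawaDomain

/-! ### The kernel and the cokernel of the control map -/

section LiftsCoboundaries

variable {Λ : Type*} [CommRing Λ] {J N : Type*} [Group J] [AddCommGroup N] [Module Λ N]

/-- `b` times a coboundary killed by `g` is the coboundary of an element killed by `g`. -/
def LiftsCoboundaries (τ : Representation Λ J N) (g b : Λ) : Prop :=
  ∀ n, (∀ σ, g • (τ σ n - n) = 0) → ∃ n', g • n' = 0 ∧ ∀ σ, τ σ n' - n' = b • (τ σ n - n)

theorem LiftsCoboundaries.of_invariants {τ : Representation Λ J N} {g b : Λ}
    (h : ∀ w ∈ τ.invariants, ∃ w' ∈ τ.invariants, b • w = g • w') : LiftsCoboundaries τ g b :=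
  fun _ hn => exists_torsion_coboundary τ h hn

theorem LiftsCoboundaries.zero (τ : Representation Λ J N) : LiftsCoboundaries τ 0 1 :=
  fun n _ => ⟨n, zero_smul _ _, fun _ => (one_smul _ _).symm⟩

theorem LiftsCoboundaries.of_trivial {τ : Representation Λ J N} (h : ∀ σ, τ σ = 1) (g : Λ) :
    LiftsCoboundaries τ g 1 :=
  fun _ _ => ⟨0, smul_zero _, fun σ => by simp [h]⟩

theorem LiftsCoboundaries.of_equiv {N' : Type*} [AddCommGroup N'] [Module Λ N']
    {τ : Representation Λ J N} {τ' : Representation Λ J N'} (e : N ≃ₗ[Λ] N')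
    (he : ∀ σ n, e (τ σ n) = τ' σ (e n)) {g b : Λ} (h : LiftsCoboundaries τ' g b) :
    LiftsCoboundaries τ g b := by
  intro n hn
  obtain ⟨n', hn', hc⟩ := h (e n) fun σ => by rw [← he, ← map_sub, ← map_smul, hn, map_zero]
  refine ⟨e.symm n', by rw [← map_smul, hn', map_zero], fun σ => e.injective ?_⟩
  rw [map_sub, he, e.apply_symm_apply, hc, map_smul, map_sub, he]

end LiftsCoboundaries

section H1

variable {Λ G M : Type*} [CommRing Λ] [Group G] [TopologicalSpace G] [AddCommGroup M] [Module Λ M]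

theorem H1.mk_eq_zero_iff (ρ : Representation Λ G M) (c : Z1 ρ) :
    H1.mk ρ c = 0 ↔ ∃ m, ∀ σ, c.1 σ = ρ σ m - m := by
  refine (Submodule.Quotient.mk_eq_zero ((B1 ρ).comap (Z1 ρ).subtype)).trans ?_
  exact ⟨fun ⟨m, hm⟩ => ⟨m, fun σ => (congrFun hm σ).symm⟩,
    fun ⟨m, hm⟩ => ⟨m, funext fun σ => (hm σ).symm⟩⟩

theorem mem_tors_span_singleton {g : Λ} {m : M} : m ∈ tors Λ (Ideal.span {g}) M ↔ g • m = 0 := by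
  rw [Submodule.mem_torsionBySet_iff]
  refine ⟨fun h => h ⟨g, Ideal.mem_span_singleton_self g⟩, fun h a => ?_⟩
  obtain ⟨a, ha⟩ := a
  obtain ⟨z, rfl⟩ := Ideal.mem_span_singleton'.1 ha
  change (z * g) • m = 0
  rw [mul_smul, h, smul_zero]

end H1

/-! ### Lifting classes and local conditions to `M[g]` -/

section Control

variable {F : Type*} [Field F] {Λ M : Type*} [CommRing Λ] [AddCommGroup M]
  [Module Λ M] {p : ℕ} {ρ : Representation Λ (AbsGal F) M} {g b : Λ}

theorem smul_eq_zero_of_H1tors_eq_zero (hb : LiftsCoboundaries ρ g b)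
    {x : H1 (torsRep (Ideal.span {g}) ρ)} (hx : H1tors (Ideal.span {g}) ρ x = 0) : b • x = 0 := by
  obtain ⟨c, rfl⟩ := H1.mk_surjective _ x
  obtain ⟨m, hm⟩ := (H1.mk_eq_zero_iff ρ (Z1.map _ _ _ c)).1 hx
  obtain ⟨m', hm', hc⟩ := hb m fun σ => by
    rw [← hm σ]
    exact mem_tors_span_singleton.1 (c.1 σ).2
  rw [← map_smul, H1.mk_eq_zero_iff]
  refine ⟨⟨m', mem_tors_span_singleton.2 hm'⟩, fun σ => Subtype.ext ?_⟩
  change b • (c.1 σ : M) = ρ σ m' - m'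
  rw [hc, ← hm]
  rfl

/-- If gc is the coboundary of m = gm', then c minus the coboundary of m' takes values in M[g].
Local constancy of the orbit maps makes the corrected cocycle continuous. -/
theorem exists_H1tors_eq (hloc : ∀ m, IsLocallyConstant fun σ => ρ σ m)
    (hdiv : g ≠ 0 → ∀ m : M, ∃ m', g • m' = m) {x : H1 ρ} (hx : g • x = 0) :
    ∃ y, H1tors (Ideal.span {g}) ρ y = x := by
  obtain ⟨c, rfl⟩ := H1.mk_surjective _ x
  rw [← map_smul, H1.mk_eq_zero_iff] at hx
  obtain ⟨m, hm⟩ := hx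
  obtain ⟨m', hm'⟩ : ∃ m', ∀ σ, g • (c.1 σ - (ρ σ m' - m')) = 0 := by
    by_cases hg : g = 0
    · exact ⟨0, fun σ => by rw [hg, zero_smul]⟩
    · obtain ⟨m', rfl⟩ := hdiv hg m
      refine ⟨m', fun σ => ?_⟩
      have := hm σ
      rw [map_smul, ← smul_sub] at this
      rw [smul_sub, ← this]
      exact sub_self _
  let d : Z1 (torsRep (Ideal.span {g}) ρ) :=
    ⟨fun σ => ⟨c.1 σ - (ρ σ m' - m'), mem_tors_span_singleton.2 (hm' σ)⟩, by
      constructor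
      · have h1 : IsLocallyConstant fun σ => c.1 σ - (ρ σ m' - m') :=
          c.2.1.sub ((hloc m').sub (IsLocallyConstant.const m'))
        exact IsLocallyConstant.desc _ Subtype.val h1 Subtype.val_injective
      · intro σ τ
        refine Subtype.ext ?_
        change c.1 (σ * τ) - (ρ (σ * τ) m' - m') =
          (c.1 σ - (ρ σ m' - m')) + ρ σ (c.1 τ - (ρ τ m' - m'))
        rw [c.2.2, map_mul, Module.End.mul_apply, map_sub, map_sub]
        abel⟩
  refine ⟨H1.mk _ d, ?_⟩
  rw [← sub_eq_zero]
  change H1.mk ρ (Z1.map _ _ _ d) - H1.mk ρ c = 0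
  rw [← map_sub, H1.mk_eq_zero_iff]
  refine ⟨-m', fun σ => ?_⟩
  change c.1 σ - (ρ σ m' - m') - c.1 σ = ρ σ (-m') - -m'
  rw [map_neg]
  abel

variable [NumberField F] {ι : PlaceEmbeddings F}

theorem locInertia_smul_eq_zero {v : Place F}
    (hb : LiftsCoboundaries (ρ.comp (resSub ι v v.inertia).toMonoidHom) g b)
    {x : H1 (torsRep (Ideal.span {g}) ρ)}
    (hx : locInertia ι ρ v (H1tors (Ideal.span {g}) ρ x) = 0) :
    locInertia ι (torsRep (Ideal.span {g}) ρ) v (b • x) = 0 := by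
  obtain ⟨c, rfl⟩ := H1.mk_surjective _ x
  obtain ⟨m, hm⟩ := (H1.mk_eq_zero_iff _ (Z1.map _ _ _ (Z1.map _ _ _ c))).1 hx
  obtain ⟨m', hm', hc⟩ := hb m fun σ => by
    rw [← hm σ]
    exact mem_tors_span_singleton.1 (c.1 _).2
  rw [← map_smul]
  refine (H1.mk_eq_zero_iff _ (Z1.map _ _ _ (b • c))).2
    ⟨⟨m', mem_tors_span_singleton.2 hm'⟩, fun σ => Subtype.ext ?_⟩
  refine Eq.trans ?_ (hc σ).symm
  rw [← hm]
  rfl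

theorem locQuot_smul_eq_zero (Fil : LocalFiltration ι p ρ) {v : placesOver F p}
    (hdiv : g ≠ 0 → ∀ m ∈ Fil.sub v, ∃ m' ∈ Fil.sub v, g • m' = m)
    {J : Subgroup (AbsGal (v : Place F).Completion)}
    (hb : LiftsCoboundaries ((Fil.quot v).comp J.subtype) g b)
    {x : H1 (torsRep (Ideal.span {g}) ρ)}
    (hx : locQuot Fil v J (H1tors (Ideal.span {g}) ρ x) = 0) :
    locQuot (Fil.tors (Ideal.span {g})) v J (b • x) = 0 := by
  obtain ⟨c, rfl⟩ := H1.mk_surjective _ x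
  obtain ⟨n, hn⟩ := (H1.mk_eq_zero_iff _ (Z1.map _ _ _ (Z1.map _ _ _ c))).1 hx
  obtain ⟨n', hn', hc⟩ := hb n fun σ => by
    rw [← hn σ]
    change g • (Fil.sub v).mkQ (c.1 _ : M) = 0
    rw [← map_smul, mem_tors_span_singleton.1 (c.1 _).2, map_zero]
  -- The target is M[g]/(M[g] ∩ F_v⁺(M)), so n' needs a representative killed by g. Any
  -- representative is corrected by dividing its multiple by g, which lies in F_v⁺(M), inside
  -- F_v⁺(M).
  obtain ⟨m, hm, rfl⟩ : ∃ m, g • m = 0 ∧ (Fil.sub v).mkQ m = n' := by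
    obtain ⟨m, rfl⟩ := Submodule.mkQ_surjective _ n'
    by_cases hg : g = 0
    · exact ⟨m, by rw [hg, zero_smul], rfl⟩
    · rw [← map_smul, Submodule.mkQ_apply, Submodule.Quotient.mk_eq_zero] at hn'
      obtain ⟨f, hf, hfm⟩ := hdiv hg _ hn'
      refine ⟨m - f, by rw [smul_sub, hfm, sub_self], ?_⟩
      rw [map_sub, sub_eq_self, Submodule.mkQ_apply, Submodule.Quotient.mk_eq_zero]
      exact hf
  rw [← map_smul]
  refine (H1.mk_eq_zero_iff _ (Z1.map _ _ _ (b • c))).2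
    ⟨Submodule.Quotient.mk ⟨m, mem_tors_span_singleton.2 hm⟩, fun σ => ?_⟩
  have h1 : (Fil.sub v).mkQ (b • (c.1 (resSub ι v J σ) : M)) =
      (Fil.sub v).mkQ (ρ (res (ι v) σ) m - m) := by
    refine Eq.trans ?_ ((hc σ).symm.trans (map_sub (Fil.sub v).mkQ _ _).symm)
    rw [← hn]
    rfl
  exact (Submodule.Quotient.eq _).2 ((Submodule.Quotient.eq (Fil.sub v)).1 h1)

/-- An element `b` which lifts the coboundaries of all local modules kills the cokernel of the
control map. -/
theorem smul_controlCoker_eq_zero (J : LocalSubgroups F p) (Fil : LocalFiltration ι p ρ)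
    (hloc : ∀ m, IsLocallyConstant fun σ => ρ σ m)
    (hdiv : g ≠ 0 → ∀ m : M, ∃ m', g • m' = m)
    (hdivFil : ∀ v, g ≠ 0 → ∀ m ∈ Fil.sub v, ∃ m' ∈ Fil.sub v, g • m' = m)
    (haway : ∀ v ∉ placesOver F p,
      LiftsCoboundaries (ρ.comp (resSub ι v v.inertia).toMonoidHom) g b)
    (hat : ∀ v, LiftsCoboundaries ((Fil.quot v).comp (J v).subtype) g b)
    (x : controlCoker (Ideal.span {g}) J Fil) : b • x = 0 := by
  obtain ⟨y, rfl⟩ := Submodule.Quotient.mk_surjective _ x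
  rw [← Submodule.Quotient.mk_smul, Submodule.Quotient.mk_eq_zero]
  have hgy : g • (y : Sel J Fil).1 = 0 :=
    congrArg Subtype.val (mem_tors_span_singleton.1 y.2)
  obtain ⟨z, hz⟩ := exists_H1tors_eq hloc hdiv hgy
  have hy := (y : Sel J Fil).2
  simp only [Sel, Submodule.mem_inf, Submodule.mem_iInf, LinearMap.mem_ker] at hy
  have hbz : b • z ∈ Sel J (Fil.tors (Ideal.span {g})) := by
    simp only [Sel, Submodule.mem_inf, Submodule.mem_iInf, LinearMap.mem_ker]
    refine ⟨fun v => locInertia_smul_eq_zero (haway v v.2) ?_,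
      fun v => locQuot_smul_eq_zero Fil (hdivFil v) (hat v) ?_⟩
    · rw [hz]
      exact hy.1 v
    · rw [hz]
      exact hy.2 v
  refine ⟨⟨b • z, hbz⟩, Subtype.ext (Subtype.ext ?_)⟩
  change H1tors (Ideal.span {g}) ρ (b • z) = b • (y : Sel J Fil).1
  rw [map_smul, hz]

theorem smul_controlKer_eq_zero (J : LocalSubgroups F p) (Fil : LocalFiltration ι p ρ)
    (hb : LiftsCoboundaries ρ g b) (x : controlKer (Ideal.span {g}) J Fil) : b • x = 0 := by
  refine Subtype.ext (Subtype.ext (smul_eq_zero_of_H1tors_eq_zero hb ?_))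
  have h : controlMap (Ideal.span {g}) J Fil x.1 = 0 := x.2
  exact congrArg Subtype.val (congrArg Subtype.val h)

/-- This allows elements found at different places to be multiplied together. -/
theorem LiftsCoboundaries.mul_left {J N : Type*} [Group J] [AddCommGroup N] [Module Λ N]
    {τ : Representation Λ J N} (h : LiftsCoboundaries τ g b) (a : Λ) :
    LiftsCoboundaries τ g (a * b) := by
  intro n hn
  obtain ⟨n', hn', hc⟩ := h n hn
  exact ⟨a • n', by rw [smul_comm, hn', smul_zero], fun σ => by
    rw [map_smul, ← smul_sub, hc, mul_smul]⟩

end Control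

/-! ### Global invariants of `M[𝔮]` -/

section H0

variable {F : Type*} [Field F] [NumberField F] {Λ M : Type*} [CommRing Λ] [AddCommGroup M]
  [Module Λ M]

/-- The inclusion of `H⁰(F_Σ/F, M[𝔮])` in `M`. -/
noncomputable def H0SigmaIncl (ι : PlaceEmbeddings F) (S : Set (Place F)) (𝔮 : Ideal Λ)
    (ρ : Representation Λ (AbsGal F) M) : H0Sigma ι S (torsRep 𝔮 ρ) →ₗ[Λ] M :=
  (tors Λ 𝔮 M).subtype ∘ₗ (Submodule.subtype _) ∘ₗ (Submodule.subtype _)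

theorem H0SigmaIncl_injective (ι : PlaceEmbeddings F) (S : Set (Place F)) (𝔮 : Ideal Λ)
    (ρ : Representation Λ (AbsGal F) M) : Function.Injective (H0SigmaIncl ι S 𝔮 ρ) := by
  intro x y h
  exact Subtype.ext (Subtype.ext (Subtype.ext h))

/-- Passing through Gal(F_Σ/F) loses nothing: elements fixed by G_F are fixed by Gal(F̄/F_Σ). -/
theorem mem_range_H0SigmaIncl_iff (ι : PlaceEmbeddings F) (S : Set (Place F)) {g : Λ}
    (ρ : Representation Λ (AbsGal F) M) (m : M) :
    m ∈ LinearMap.range (H0SigmaIncl ι S (Ideal.span {g}) ρ) ↔ m ∈ ρ.invariants ∧ g • m = 0 := by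
  constructor
  · rintro ⟨x, rfl⟩
    refine ⟨fun σ => ?_, mem_tors_span_singleton.1 x.1.1.2⟩
    have h : Representation.quotientToInvariants (torsRep (Ideal.span {g}) ρ)
        (maxUnramifiedOutside ι S).fixingSubgroup (QuotientGroup.mk σ) x.1 = x.1 := x.2 _
    exact congrArg Subtype.val (congrArg Subtype.val h)
  · rintro ⟨hm, hgm⟩
    let t : tors Λ (Ideal.span {g}) M := ⟨m, mem_tors_span_singleton.2 hgm⟩
    have ht : ∀ σ, torsRep (Ideal.span {g}) ρ σ t = t := fun σ => Subtype.ext (hm σ)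
    refine ⟨⟨⟨t, fun σ => ht σ⟩, fun q => ?_⟩, rfl⟩
    induction q using QuotientGroup.induction_on with
    | H σ => exact Subtype.ext (ht σ)

end H0

/-! ### Control for `𝐀` -/

section

variable {Λ : Type*} [CommRing Λ]

theorem exists_notMem_forall_of_finite {α : Type*} {S : Set α} (hS : S.Finite) {P : Ideal Λ}
    (hP : P.IsPrime) {Q : α → Λ → Prop} (hQ : ∀ v a b, Q v b → Q v (a * b))
    (h : ∀ v ∈ S, ∃ b ∉ P, Q v b) : ∃ b ∉ P, ∀ v ∈ S, Q v b := by
  induction S, hS using Set.Finite.induction_on with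
  | empty => exact ⟨1, hP.one_notMem, fun _ h => absurd h (Set.notMem_empty _)⟩
  | @insert v S _ _ ih =>
    obtain ⟨b, hb, hbQ⟩ := ih fun w hw => h w (Set.mem_insert_of_mem _ hw)
    obtain ⟨c, hc, hcQ⟩ := h v (Set.mem_insert _ _)
    refine ⟨c * b, fun hm => (hP.mem_or_mem hm).elim hc hb, ?_⟩
    rintro w (rfl | hw)
    · rw [mul_comm]
      exact hQ _ _ _ hcQ
    · exact hQ _ _ _ (hbQ w hw)

variable {p : ℕ} [Fact p.Prime]

/-- An annihilator of X also annihilates its dual, so no finiteness of the dual is needed. -/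
theorem pseudoNull_dual_of_exists_smul_eq_zero {X : Type*} [AddCommGroup X] [Module Λ X]
    (h : ∀ P : PrimeSpectrum Λ, P.asIdeal.height < 2 → ∃ b ∉ P.asIdeal, ∀ x : X, b • x = 0) :
    PseudoNull Λ (Dual p X) := by
  refine pseudoNull_of_exists_smul_eq_zero fun P hP => ?_
  obtain ⟨b, hb, hx⟩ := h P hP
  refine ⟨b, hb, fun χ => Dual.ext fun x => ?_⟩
  rw [Dual.smul_apply, hx, map_zero]
  rfl

end

section BigControl

open Filter Topology

variable {p : ℕ} [Fact p.Prime] {F : Type*} [Field F] {Λ T : Type*} [CommRing Λ]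
  [TopologicalSpace Λ] [IsTopologicalRing Λ] [IsLinearTopology Λ Λ] [AddCommGroup T] [Module Λ T]

theorem exists_isOpen_ideal_smul_eq_zero (φ : ringDual p Λ) :
    ∃ U : Ideal Λ, IsOpen (U : Set Λ) ∧ ∀ a ∈ U, a • φ = 0 := by
  obtain ⟨U, hU, hφ⟩ := exists_isOpen_ideal_of_mem_ringDual φ.2
  exact ⟨U, hU, fun a ha => Subtype.ext (Dual.ext fun x => hφ _ (U.mul_mem_right x ha))⟩

/-- `𝐀` is a discrete Galois module. -/
theorem isLocallyConstant_repA [Module.Free Λ T] [Module.Finite Λ T] [TopologicalSpace T]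
    [IsModuleTopology Λ T] (ρ : Representation Λ (AbsGal F) T)
    (hρ : Continuous fun x : AbsGal F × T => ρ x.1 x.2) (m : BigA p Λ T) :
    IsLocallyConstant fun σ => repA p ρ σ m := by
  change T ⊗[Λ] ringDual p Λ at m
  change IsLocallyConstant fun σ => (ρ σ).rTensor (ringDual p Λ) m
  induction m with
  | zero => simp only [map_zero]; exact IsLocallyConstant.const 0
  | add a b ha hb => simp only [map_add]; exact ha.add hb
  | tmul x φ =>
    simp only [LinearMap.rTensor_tmul]
    obtain ⟨U, hU, hφ⟩ := exists_isOpen_ideal_smul_eq_zero φ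
    let b := Module.Free.chooseBasis Λ T
    have hc : ∀ i, Continuous fun σ => b.coord i (ρ σ x) := fun i =>
      (IsModuleTopology.continuous_of_linearMap (b.coord i)).comp
        (hρ.comp (Continuous.prodMk_left x))
    refine (IsLocallyConstant.iff_eventually_eq _).2 fun σ => ?_
    -- For τ near σ the coordinates of ρ(τ)x - ρ(σ)x lie in U, which kills φ.
    have hev : ∀ i, ∀ᶠ τ in 𝓝 σ, b.coord i (ρ τ x) - b.coord i (ρ σ x) ∈ U := by
      intro i
      have h1 : Continuous fun τ => b.coord i (ρ τ x) - b.coord i (ρ σ x) :=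
        (hc i).sub continuous_const
      refine (hU.preimage h1).mem_nhds ?_
      change b.coord i (ρ σ x) - b.coord i (ρ σ x) ∈ U
      rw [sub_self]
      exact U.zero_mem
    filter_upwards [eventually_all.2 hev] with τ hτ
    rw [← sub_eq_zero, ← TensorProduct.sub_tmul, ← b.sum_repr (ρ τ x - ρ σ x),
      TensorProduct.sum_tmul]
    refine Finset.sum_eq_zero fun i _ => ?_
    rw [TensorProduct.smul_tmul, hφ, TensorProduct.tmul_zero]
    have h2 := hτ i
    rwa [← map_sub] at h2

section

variable [NumberField F] {ι : PlaceEmbeddings F}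

/-- Right exactness of the tensor product identifies 𝐀/F_v⁺(𝐀) with (𝐓/F_v⁺(𝐓)) ⊗ Λ^∨ equivariantly,
even if F_v⁺(𝐓) is not a direct summand. -/
theorem LiftsCoboundaries.filA_quot {ρ : Representation Λ (AbsGal F) T}
    (Fil : LocalFiltration ι p ρ) (v : placesOver F p)
    (J : Subgroup (AbsGal (v : Place F).Completion)) {g b : Λ}
    (h : LiftsCoboundaries (tensorRep p ((Fil.quot v).comp J.subtype)) g b) :
    LiftsCoboundaries (((filA (p := p) Fil).quot v).comp J.subtype) g b := by
  let e : (T ⊗[Λ] ringDual p Λ ⧸ LinearMap.range ((Fil.sub v).subtype.rTensor (ringDual p Λ))) ≃ₗ[Λ]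
      (T ⧸ Fil.sub v) ⊗[Λ] ringDual p Λ :=
    rTensor.equiv (ringDual p Λ) (LinearMap.exact_subtype_mkQ (Fil.sub v))
      (Submodule.mkQ_surjective _)
  refine LiftsCoboundaries.of_equiv (N := BigA p Λ T ⧸ (filA (p := p) Fil).sub v) e (fun σ n => ?_) h
  obtain ⟨m, rfl⟩ := Submodule.mkQ_surjective _ n
  change (Fil.sub v).mkQ.rTensor (ringDual p Λ) ((ρ (res (ι v) σ)).rTensor (ringDual p Λ) m) =
    ((Fil.quot v) σ).rTensor (ringDual p Λ) ((Fil.sub v).mkQ.rTensor (ringDual p Λ) m)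
  have h1 : (Fil.sub v).mkQ ∘ₗ ρ (res (ι v) σ) = (Fil.quot v) σ ∘ₗ (Fil.sub v).mkQ := rfl
  have h2 := congrArg (LinearMap.rTensor (ringDual p Λ)) h1
  rw [LinearMap.rTensor_comp, LinearMap.rTensor_comp] at h2
  exact LinearMap.congr_fun h2 m

/-- The conditions on `b` at the place `v` under which `b` kills the local obstruction. -/
def LiftsLocalCoboundaries (J : LocalSubgroups F p) {ρ : Representation Λ (AbsGal F) T}
    (Fil : LocalFiltration ι p ρ) (g : Λ) (v : Place F) (b : Λ) : Prop :=
  (v ∉ placesOver F p →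
    LiftsCoboundaries ((repA p ρ).comp (resSub ι v v.inertia).toMonoidHom) g b) ∧
  ∀ hv : v ∈ placesOver F p,
    LiftsCoboundaries (((filA (p := p) Fil).quot ⟨v, hv⟩).comp (J ⟨v, hv⟩).subtype) g b

theorem liftsLocalCoboundaries_of_unramified {ρ : Representation Λ (AbsGal F) T}
    (Fil : LocalFiltration ι p ρ) (g : Λ) (J : LocalSubgroups F p) {v : Place F}
    (hv : v ∉ placesOver F p) (hρ : ∀ σ ∈ v.inertia, ρ (res (ι v) σ) = 1) :
    LiftsLocalCoboundaries J Fil g v 1 := by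
  refine ⟨fun _ => LiftsCoboundaries.of_trivial (fun σ => ?_) g, fun h' => absurd h' hv⟩
  change (ρ (res (ι v) σ)).rTensor (ringDual p Λ) = 1
  rw [hρ σ σ.2]
  exact LinearMap.rTensor_id _ _

end

variable [CompactSpace Λ] [T2Space Λ] [IsDomain Λ] [IsNoetherianRing Λ]

theorem exists_liftsCoboundaries (hp : Tendsto (fun n => (p : Λ) ^ n) atTop (𝓝 0))
    {X J : Type*} [AddCommGroup X] [Module Λ X] [Module.Finite Λ X] [Group J]
    (τ : Representation Λ J X) {g : Λ}
    (hC : PseudoNull Λ (torsCoinv τ ⧸ (Ideal.span {g} • ⊤ : Submodule Λ (torsCoinv τ))))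
    {P : PrimeSpectrum Λ} (hP : P.asIdeal.height < 2) :
    ∃ b ∉ P.asIdeal, LiftsCoboundaries (tensorRep p τ) g b := by
  -- For g = 0 the torsion is the whole module and b = 1 works; the torsion of the coinvariants is
  -- only relevant for g ≠ 0.
  by_cases hg : g = 0
  · exact ⟨1, P.2.one_notMem, hg ▸ LiftsCoboundaries.zero _⟩
  · obtain ⟨b, hb, h⟩ := exists_smul_invariants_of_torsCoinv hp τ hg hC hP
    exact ⟨b, hb, LiftsCoboundaries.of_invariants h⟩

variable [NumberField F] {ι : PlaceEmbeddings F}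

theorem exists_liftsCoboundaries_of_dual (hp : Tendsto (fun n => (p : Λ) ^ n) atTop (𝓝 0))
    [Module.Finite Λ T] (ρ : Representation Λ (AbsGal F) T) {V : Type*} [AddCommGroup V]
    [Module Λ V] (j : V →ₗ[Λ] BigA p Λ T) (hj : Function.Injective j) {g : Λ}
    (hV : ∀ m, m ∈ LinearMap.range j ↔ m ∈ (repA p ρ).invariants ∧ g • m = 0)
    (hpn : PseudoNull Λ (Dual p V)) {P : PrimeSpectrum Λ} (hP : P.asIdeal.height < 2) :
    ∃ b ∉ P.asIdeal, LiftsCoboundaries (repA p ρ) g b := by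
  -- The dual of 𝐀 is an image of 𝐓^*; its finiteness is what Cayley–Hamilton requires.
  have hfin : Module.Finite Λ (Dual p (BigA p Λ T)) :=
    Module.Finite.of_surjective (pairing p : (T →ₗ[Λ] Λ) →ₗ[Λ] _) (pairing_surjective hp)
  have htors : ∀ n : BigA p Λ T, ∃ k : ℕ, (p ^ k) • n = 0 := tensor_isTorsion hp
  obtain ⟨b, hb, hbW⟩ := exists_smul_invariants_of_dual htors (repA p ρ).invariants j hj hV hpn hP
  exact ⟨b, hb, LiftsCoboundaries.of_invariants hbW⟩

theorem exists_liftsCoboundaries_of_H0Sigma (hp : Tendsto (fun n => (p : Λ) ^ n) atTop (𝓝 0))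
    [Module.Finite Λ T] (ρ : Representation Λ (AbsGal F) T) (S : Set (Place F)) (g : Λ)
    (hH0 : PseudoNull Λ (Dual p (H0Sigma ι S (torsRep (Ideal.span {g}) (repA p ρ)))))
    {P : PrimeSpectrum Λ} (hP : P.asIdeal.height < 2) :
    ∃ b ∉ P.asIdeal, LiftsCoboundaries (repA p ρ) g b :=
  exists_liftsCoboundaries_of_dual hp ρ (H0SigmaIncl ι S (Ideal.span {g}) (repA p ρ))
    (H0SigmaIncl_injective ι S (Ideal.span {g}) (repA p ρ))
    (mem_range_H0SigmaIncl_iff ι S (repA p ρ)) hH0 hP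

theorem exists_liftsLocalCoboundaries (hp : Tendsto (fun n => (p : Λ) ^ n) atTop (𝓝 0))
    [Module.Finite Λ T] {ρ : Representation Λ (AbsGal F) T} {S : Set (Place F)}
    (Fil : LocalFiltration ι p ρ) (g : Λ) (J : LocalSubgroups F p)
    (hloc : LocalModulesPseudoNull J S (Ideal.span {g}) Fil)
    {P : PrimeSpectrum Λ} (hP : P.asIdeal.height < 2) {v : Place F} (hvS : v ∈ S) :
    ∃ b ∉ P.asIdeal, LiftsLocalCoboundaries J Fil g v b := by
  by_cases hv : v ∈ placesOver F p
  · obtain ⟨b, hb, h⟩ := exists_liftsCoboundaries hp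
      ((Fil.quot ⟨v, hv⟩).comp (J ⟨v, hv⟩).subtype) (hloc.1 ⟨v, hv⟩ hvS) hP
    exact ⟨b, hb, fun h' => absurd hv h', fun _ => h.filA_quot Fil ⟨v, hv⟩ _⟩
  · obtain ⟨b, hb, h⟩ := exists_liftsCoboundaries hp
      (ρ.comp (resSub ι v v.inertia).toMonoidHom) (hloc.2 v hvS hv) hP
    exact ⟨b, hb, fun _ => h, fun h' => absurd h' hv⟩

/-- Divisibility passes to F_v⁺(𝐀) as an image of the divisible module F_v⁺(𝐓) ⊗ Λ^∨. -/
theorem exists_smul_eq_of_mem_filA (hp : Tendsto (fun n => (p : Λ) ^ n) atTop (𝓝 0))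
    {ρ : Representation Λ (AbsGal F) T} (Fil : LocalFiltration ι p ρ) (v : placesOver F p) {g : Λ}
    (hg : g ≠ 0) {m : BigA p Λ T} (hm : m ∈ (filA (p := p) Fil).sub v) :
    ∃ m' ∈ (filA (p := p) Fil).sub v, g • m' = m := by
  obtain ⟨x, rfl⟩ := hm
  obtain ⟨x', rfl⟩ := exists_smul_eq_of_ne_zero hp hg x
  exact ⟨_, ⟨x', rfl⟩, (map_smul ((Fil.sub v).subtype.rTensor (ringDual p Λ)) g x').symm⟩

theorem controlPseudoNull_of_localModulesPseudoNull
    (hp : Tendsto (fun n => (p : Λ) ^ n) atTop (𝓝 0)) [Module.Free Λ T] [Module.Finite Λ T]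
    [TopologicalSpace T] [IsModuleTopology Λ T] (ρ : Representation Λ (AbsGal F) T)
    (hρ : Continuous fun x : AbsGal F × T => ρ x.1 x.2)
    {S : Set (Place F)} (hS : S.Finite) (hpS : placesOver F p ⊆ S)
    (hρ_unr : ∀ v ∉ S, ∀ σ ∈ v.inertia, ρ (res (ι v) σ) = 1)
    (Fil : LocalFiltration ι p ρ) (g : Λ)
    (hH0 : PseudoNull Λ (Dual p (H0Sigma ι S (torsRep (Ideal.span {g}) (repA p ρ)))))
    (J : LocalSubgroups F p) (hloc : LocalModulesPseudoNull J S (Ideal.span {g}) Fil) :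
    ControlPseudoNull J (Ideal.span {g}) Fil := by
  refine ⟨pseudoNull_dual_of_exists_smul_eq_zero fun P hP => ?_,
    pseudoNull_dual_of_exists_smul_eq_zero fun P hP => ?_⟩
  · obtain ⟨b, hb, h⟩ := exists_liftsCoboundaries_of_H0Sigma hp ρ S g hH0 hP
    exact ⟨b, hb, smul_controlKer_eq_zero J _ h⟩
  · obtain ⟨b, hb, h⟩ := exists_notMem_forall_of_finite hS P.2
      (Q := LiftsLocalCoboundaries J Fil g)
      (fun v a b h => ⟨fun hv => (h.1 hv).mul_left a, fun hv => (h.2 hv).mul_left a⟩)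
      (fun v hv => exists_liftsLocalCoboundaries hp Fil g J hloc hP hv)
    have hall : ∀ v, LiftsLocalCoboundaries J Fil g v b := by
      intro v
      by_cases hv : v ∈ S
      · exact h v hv
      · have h1 := liftsLocalCoboundaries_of_unramified Fil g J (fun h' => hv (hpS h'))
          (hρ_unr v hv)
        -- Outside S the element 1 already lifts coboundaries, hence so does its multiple b.
        rw [← mul_one b]
        exact ⟨fun hv => (h1.1 hv).mul_left b, fun hv => (h1.2 hv).mul_left b⟩
    exact ⟨b, hb, smul_controlCoker_eq_zero J (filA Fil) (isLocallyConstant_repA ρ hρ)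
      (fun hg => exists_smul_eq_of_ne_zero (X := T) hp hg)
      (fun v hg m hm => exists_smul_eq_of_mem_filA hp Fil v hg hm)
      (fun v hv => (hall v).1 hv) (fun v => (hall v).2 v.2)⟩

end BigControl

end SelmerControl

open SelmerControl in
theorem mainTheorem3
    -- The number field `F`, the prime `p`, and the `ℤ_p`-extension `F_∞/F`.
    (p : ℕ) [Fact p.Prime] (F : Type*) [Field F] [NumberField F] (ι : PlaceEmbeddings F)
    (E : ZpExtension p F)
    (hE_unr : ∀ v ∉ placesOver F p, UnramifiedAt ι E.field v)
    (hE_ram : ∀ v ∈ placesOver F p, TotallyRamifiedAt ι E.field v)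
    -- The coefficient ring `R`.
    (R : Type*) [CommRing R] [IsRegularLocalRing R]
    [IsAdicComplete (IsLocalRing.maximalIdeal R) R] (hR : 1 ≤ ringKrullDim R)
    [Finite (IsLocalRing.ResidueField R)] [CharP (IsLocalRing.ResidueField R) p]
    -- The Galois representation `𝐓`, unramified outside `S`, and its filtrations at `v ∣ p`.
    (T : Type*) [AddCommGroup T] [Module (Iwasawa E R) T] [Module.Free (Iwasawa E R) T]
    [Module.Finite (Iwasawa E R) T] [TopologicalSpace T] [IsModuleTopology (Iwasawa E R) T]
    (ρ : Representation (Iwasawa E R) (AbsGal F) T)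
    (hρ : Continuous fun x : AbsGal F × T => ρ x.1 x.2)
    (S : Set (Place F)) (hS : S.Finite) (hpS : placesOver F p ⊆ S)
    (hρ_unr : ∀ v ∉ S, ∀ σ ∈ v.inertia, ρ (res (ι v) σ) = 1)
    (Fil : LocalFiltration ι p ρ)
    -- The principal ideal `𝔮`.
    (𝔮 : Ideal (Iwasawa E R)) (hq : 𝔮.IsPrincipal)
    (hH0 : PseudoNull (Iwasawa E R) (Dual p ↥(H0Sigma ι S (torsRep 𝔮 (repA p ρ))))) :
    (LocalModulesPseudoNull (greenberg F p) S 𝔮 Fil →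
      ControlPseudoNull (greenberg F p) 𝔮 Fil) ∧
    (LocalModulesPseudoNull (strict F p) S 𝔮 Fil →
      ControlPseudoNull (strict F p) 𝔮 Fil) := by
  have := Iwasawa.isNoetherianRing E R
  have := Iwasawa.isDomain E R
  obtain ⟨g, rfl⟩ := hq.principal
  have hp := Iwasawa.tendsto_natCast_pow E R
  exact ⟨fun h => controlPseudoNull_of_localModulesPseudoNull hp ρ hρ hS hpS hρ_unr Fil g hH0 _ h,
    fun h => controlPseudoNull_of_localModulesPseudoNull hp ρ hρ hS hpS hρ_unr Fil g hH0 _ h⟩
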